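/- Let $G$ be a non-empty planar diagram of an unoriented 4-valent graph (rigid vertices; free loops and crossings allowed), with $v$ vertices. Its Kauffman–Vogel polynomial $[G]$ in the variables $A,B,a$ is obtained by expanding every vertex by the relation $$[\text{vertex}]=[\text{crossing}]-A\,[\text{smoothing}]-B\,[\text{other smoothing}],$$ the $A$-smoothing being the one that respects the orientations of the two strands for which the crossing is positive, and evaluating the resulting link diagrams by the Dubrovnik polynomial with variables $A-B$ and $a$. The latter is the regular isotopy invariant of unoriented link diagrams that equals $1$ on the circle, is multiplied by $a^{\pm1}$ when a curl of sign $\pm1$ is added, and satisfies $[L_+]-[L_-]=(A-B)([L_0]-[L_\infty])$, where $L_+,L_-$ differ by switching one crossing and $L_0,L_\infty$ are its $A$- and $B$-smoothing with respect to $L_+$. An orientation of the edges of $G$ (constant through crossings) is hyperbolic if at each vertex two opposite half-edges point in and the other two point out. Let $\mathcal H$ be the set of hyperbolic orientations of $G$, and for $h\in\mathcal H$ let $w(G^h)$ be the sum of the signs of all crossings of $G$ oriented by $h$. Then, for $B=A^{-1}$ and $a=A$ (over any field in which $2\neq 0$, with $A\ne0$, $A^2\neq1$; for instance $A$ an indeterminate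 over $\mathbb Q$), the Dubrovnik polynomial with variables $A-A^{-1}$ and $A$ exists and is unique, every Kauffman–Vogel polynomial over a commutative ring specialises, under any ring homomorphism to the field sending its variables $A,B,a$ to $A,A^{-1},A$, to $[G]$ at these values, and $$[G]=\tfrac12\,(-A-A^{-1})^{v}\sum_{h\in\mathcal H}A^{w(G^h)} .$$ -/

import Mathlib

namespace KauffmanVogel

/-!  Unoriented diagrams of 4-valent rigid vertex graphs in the plane, in Morse position.

A diagram is cut by horizontal lines into slices, each holding exactly one elementary piece
(a local minimum, a local maximum, a crossing or a 4-valent vertex) next to vertical strands.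
It is recorded as the list of its pieces, read from bottom to top. Every diagram is of this form
after a planar isotopy. -/

/-- The elementary pieces. `cross true` is the crossing whose over-strand runs from bottom left to
top right (positive when both strands point upwards); `cross false` is the crossing whose
over-strand runs from bottom right to top left. A `vertex` has two half-edges at the bottom and two
at the top; bottom left is opposite to top right. -/
inductive Elem
  | cup
  | cap
  | cross (pos : Bool)
  | vertex

/-- Number of strand ends at the bottom of a piece. -/
def Elem.inWidth : Elem → ℕ
  | .cup => 0
  | _ => 2

/-- Number of strand ends at the top of a piece. -/
def Elem.outWidth : Elem → ℕ
  | .cap => 0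
  | _ => 2

/-- Whether a piece is a vertex. -/
def Elem.isVertex : Elem → Bool
  | .vertex => true
  | _ => false

/-- A slice: the elementary piece, and the number of vertical strands to its left. -/
structure Piece where
  elem : Elem
  left : ℕ

/-- The piece with `i` strands to its left. -/
abbrev cup (i : ℕ) : Piece := ⟨.cup, i⟩
/-- The piece with `i` strands to its left. -/
abbrev cap (i : ℕ) : Piece := ⟨.cap, i⟩
/-- The piece with `i` strands to its left. -/
abbrev cross (b : Bool) (i : ℕ) : Piece := ⟨.cross b, i⟩
/-- The piece with `i` strands to its left. -/
abbrev vertex (i : ℕ) : Piece := ⟨.vertex, i⟩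

/-- `IsTangle w n m`: the slices in `w` fit together to a picture with `n` strand ends at the
bottom and `m` at the top. -/
def IsTangle : List Piece → ℕ → ℕ → Prop
  | [], n, m => n = m
  | p :: w, n, m =>
      p.left + p.elem.inWidth ≤ n ∧ IsTangle w (n - p.elem.inWidth + p.elem.outWidth) m

/-- A non-empty closed diagram of a 4-valent graph (free loops are allowed). -/
structure GraphDiagram where
  word : List Piece
  ne_nil : word ≠ []
  closed : IsTangle word 0 0

/-- The number of vertices of the graph. -/
def GraphDiagram.numVertices (G : GraphDiagram) : ℕ :=
  G.word.countP (fun p => p.elem.isVertex)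

/-- A link diagram is a graph diagram without vertices. -/
structure LinkDiagram extends GraphDiagram where
  no_vertex : ∀ p ∈ word, p.elem ≠ .vertex

/-! ### Regular isotopy and the Dubrovnik polynomial -/

/-- The local moves that generate regular isotopy of link diagrams in Morse position. -/
inductive RegularMove : List Piece → List Piece → Prop
  /-- Planar isotopy: exchange of the heights of two distant pieces. -/
  | exchange (x y : Elem) (i k : ℕ) :
      RegularMove [⟨x, i⟩, ⟨y, i + x.outWidth + k⟩] [⟨y, i + x.inWidth + k⟩, ⟨x, i⟩]
  /-- Planar isotopy: straightening a strand. -/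
  | zigzagRight (i : ℕ) : RegularMove [cup (i + 1), cap i] []
  /-- Planar isotopy: straightening a strand. -/
  | zigzagLeft (i : ℕ) : RegularMove [cup i, cap (i + 1)] []
  /-- Planar isotopy: a crossing slides through a minimum of one of its strands. -/
  | slideCup (b : Bool) (i : ℕ) :
      RegularMove [cup i, cross b (i + 1)] [cup (i + 1), cross (!b) i]
  /-- Planar isotopy: a crossing slides through a maximum of one of its strands. -/
  | slideCap (b : Bool) (i : ℕ) :
      RegularMove [cross b i, cap (i + 1)] [cross (!b) (i + 1), cap i]
  /-- The second Reidemeister move. -/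
  | reidemeister2 (b : Bool) (i : ℕ) : RegularMove [cross b i, cross (!b) i] []
  /-- The third Reidemeister move. -/
  | reidemeister3 (b : Bool) (i : ℕ) :
      RegularMove [cross b i, cross b (i + 1), cross b i]
        [cross b (i + 1), cross b i, cross b (i + 1)]

/-- `IsCurl b w`: `w` is one strand with a curl, to its right or to its left, whose crossing has
sign `+` for `b = true` and `-` for `b = false` (in either direction of the strand). -/
inductive IsCurl : Bool → List Piece → Prop
  | right (b : Bool) (i : ℕ) : IsCurl b [cup (i + 1), cross b i, cap (i + 1)]
  | left (b : Bool) (i : ℕ) : IsCurl b [cup i, cross b (i + 1), cap i]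

/-- `D` is a Dubrovnik polynomial with variables `z` and `a`: a regular isotopy invariant of
unoriented link diagrams that is `1` on the round circle, is multiplied by `a` or `a⁻¹` when a
positive or a negative curl is added, and satisfies the Dubrovnik skein relation. -/
structure IsDubrovnik {R : Type*} [CommRing R] (z : R) (a : Rˣ) (D : LinkDiagram → R) : Prop where
  regular_isotopy : ∀ (u v p q : List Piece) (L L' : LinkDiagram), RegularMove p q →
    L.word = u ++ p ++ v → L'.word = u ++ q ++ v → D L = D L'
  curl_pos : ∀ (u v p : List Piece) (L L' : LinkDiagram), IsCurl true p →
    L.word = u ++ p ++ v → L'.word = u ++ v → D L = (a : R) * D L'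
  curl_neg : ∀ (u v p : List Piece) (L L' : LinkDiagram), IsCurl false p →
    L.word = u ++ p ++ v → L'.word = u ++ v → D L = ((a⁻¹ : Rˣ) : R) * D L'
  skein : ∀ (u v : List Piece) (i : ℕ) (L₁ L₂ L₃ L₄ : LinkDiagram),
    L₁.word = u ++ [cross true i] ++ v → L₂.word = u ++ [cross false i] ++ v →
    L₃.word = u ++ v → L₄.word = u ++ [cap i, cup i] ++ v →
    D L₁ - D L₂ = z * (D L₃ - D L₄)
  circle : ∀ L : LinkDiagram, L.word = [cup 0, cap 0] → D L = 1

/-- The Dubrovnik polynomial with variables `z` and `a`: the function determined by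
`IsDubrovnik z a`. -/
noncomputable def dubrovnik {R : Type*} [CommRing R] (z : R) (a : Rˣ) : LinkDiagram → R :=
  Classical.epsilon (IsDubrovnik z a)

/-! ### The Kauffman-Vogel polynomial -/

/-- The local states of a piece, with their weights. By the skein relation
`[crossing] = A [smoothing] + B [other smoothing] + [vertex]`, a vertex is the positive crossing
minus `A` times the smoothing `)(` minus `B` times the other smoothing. -/
def localStates {R : Type*} [CommRing R] (A B : R) (p : Piece) : List (R × List Piece) :=
  match p.elem with
  | .vertex => [(1, [cross true p.left]), (-A, []), (-B, [cap p.left, cup p.left])]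
  | _ => [(1, [p])]

/-- All states of a diagram, with their weights: one local state is chosen for each piece, the
pictures are stacked and the weights multiplied. -/
def states {R : Type*} [CommRing R] (A B : R) : List Piece → List (R × List Piece)
  | [] => [(1, [])]
  | p :: w => (localStates A B p).flatMap fun s =>
      (states A B w).map fun t => (s.1 * t.1, s.2 ++ t.2)

theorem states_isTangle {R : Type*} [CommRing R] (A B : R) (w : List Piece) :
    ∀ n m, IsTangle w n m → ∀ s ∈ states A B w, IsTangle s.2 n m := by
  induction w with
  | nil =>
    intro n m h s hs
    simp only [states, List.mem_singleton] at hs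
    subst hs
    exact h
  | cons p w ih =>
    intro n m h s hs
    obtain ⟨e, i⟩ := p
    simp only [states, List.mem_flatMap, List.mem_map] at hs
    obtain ⟨x, hx, t, ht, rfl⟩ := hs
    obtain ⟨h1, h2⟩ := h
    have h3 := ih _ _ h2 t ht
    cases e <;> simp [localStates, Elem.inWidth, Elem.outWidth] at hx h1 h3
    · subst hx; exact ⟨h1, h3⟩
    · subst hx; exact ⟨h1, h3⟩
    · subst hx; exact ⟨h1, h3⟩
    · have e1 : n - 2 + 2 = n := by omega
      rcases hx with rfl | rfl | rfl
      · exact ⟨h1, h3⟩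
      · rw [e1] at h3; exact h3
      · refine ⟨h1, ?_, ?_⟩
        · simp [Elem.inWidth, Elem.outWidth]; omega
        · simpa [Elem.inWidth, Elem.outWidth] using h3

theorem states_no_vertex {R : Type*} [CommRing R] (A B : R) (w : List Piece) :
    ∀ s ∈ states A B w, ∀ p ∈ s.2, p.elem ≠ .vertex := by
  induction w with
  | nil =>
    intro s hs p hp
    simp only [states, List.mem_singleton] at hs
    subst hs
    simp at hp
  | cons q w ih =>
    intro s hs p hp
    obtain ⟨e, i⟩ := q
    simp only [states, List.mem_flatMap, List.mem_map] at hs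
    obtain ⟨x, hx, t, ht, rfl⟩ := hs
    rcases List.mem_append.1 hp with hp | hp
    · cases e <;> simp [localStates] at hx
      · subst hx; simp at hp; subst hp; simp
      · subst hx; simp at hp; subst hp; simp
      · subst hx; simp at hp; subst hp; simp
      · rcases hx with rfl | rfl | rfl
        · simp at hp; subst hp; simp
        · simp at hp
        · simp at hp; rcases hp with rfl | rfl <;> simp
    · exact ih t ht p hp

theorem states_ne_nil {R : Type*} [CommRing R] (A B : R) (w : List Piece) (h0 : w ≠ [])
    (h : IsTangle w 0 0) : ∀ s ∈ states A B w, s.2 ≠ [] := by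
  intro s hs
  match w, h0 with
  | ⟨e, i⟩ :: w, _ =>
    have h1 := h.1
    cases e <;> simp [Elem.inWidth] at h1
    simp only [states, List.mem_flatMap, List.mem_map, localStates, List.mem_singleton] at hs
    obtain ⟨x, rfl, t, _, rfl⟩ := hs
    simp

/-- The link diagram of a state of `G`. -/
def GraphDiagram.stateLink {R : Type*} [CommRing R] (A B : R) (G : GraphDiagram)
    (s : {s // s ∈ states A B G.word}) : LinkDiagram where
  word := s.1.2
  ne_nil := states_ne_nil A B G.word G.ne_nil G.closed s.1 s.2
  closed := states_isTangle A B G.word 0 0 G.closed s.1 s.2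
  no_vertex := states_no_vertex A B G.word s.1 s.2

/-- The state sum of `G` with respect to a function `D` on link diagrams. -/
def bracket {R : Type*} [CommRing R] (A B : R) (D : LinkDiagram → R) (G : GraphDiagram) : R :=
  ((states A B G.word).attach.map fun s => s.1.1 * D (G.stateLink A B s)).sum

/-- The Kauffman-Vogel polynomial of `G` with variables `A`, `B`, `a`: the state sum of `G` with
respect to the Dubrovnik polynomial with variables `A - B` and `a`. -/
noncomputable def kauffmanVogel {R : Type*} [CommRing R] (A B : R) (a : Rˣ)
    (G : GraphDiagram) : R :=
  bracket A B (dubrovnik (A - B) a) G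

/-! ### Hyperbolic orientations and the writhe -/

/-- `IsLocal e x y`: the directions `x` of the bottom ends and `y` of the top ends (from left to
right; `true` is upwards) orient the piece `e`. Directions are kept along minima, maxima and
through crossings. At a vertex two opposite half-edges point in and the other two point out. -/
def IsLocal : Elem → List Bool → List Bool → Prop
  | .cup, x, y => x = [] ∧ ∃ b, y = [b, !b]
  | .cap, x, y => y = [] ∧ ∃ b, x = [b, !b]
  | .cross _, x, y => ∃ b c, x = [b, c] ∧ y = [c, b]
  | .vertex, x, y => ∃ b, x = [b, !b] ∧ y = [b, !b]

/-- `s` and `t` are the directions of the strands just below and just above the slice `p`. -/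
def IsStep (p : Piece) (s t : List Bool) : Prop :=
  ∃ l r x y : List Bool, l.length = p.left ∧ s = l ++ x ++ r ∧ t = l ++ y ++ r ∧
    IsLocal p.elem x y

/-- `IsHyperbolic w s h`: starting with directions `s` below `w`, the list `h` gives the directions
of the strands just above each slice of `w`, and they form a hyperbolic orientation. -/
def IsHyperbolic : List Piece → List Bool → List (List Bool) → Prop
  | [], _, [] => True
  | p :: w, s, t :: h => IsStep p s t ∧ IsHyperbolic w t h
  | _, _, _ => False

/-- The sign of the crossing in the slice `p` when the strands below it have directions `s`
(zero when `p` is not a crossing). -/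
def sign (p : Piece) (s : List Bool) : ℤ :=
  match p.elem, s.drop p.left with
  | .cross pos, b :: c :: _ => if pos = (b == c) then 1 else -1
  | _, _ => 0

/-- The sum of the signs of all crossings. -/
def writheAux : List Piece → List Bool → List (List Bool) → ℤ
  | p :: w, s, t :: h => sign p s + writheAux w t h
  | _, _, _ => 0

/-- The hyperbolic orientations of the diagram `G`. -/
def HyperbolicOrientation (G : GraphDiagram) : Type :=
  {h : List (List Bool) // IsHyperbolic G.word [] h}

/-- The writhe of the diagram `G` with the orientation `h`. -/
def HyperbolicOrientation.writhe {G : GraphDiagram} (h : HyperbolicOrientation G) : ℤ :=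
  writheAux G.word [] h.1

theorem finite_isHyperbolic (w : List Piece) :
    ∀ s : List Bool, {h | IsHyperbolic w s h}.Finite := by
  induction w with
  | nil =>
    intro s
    refine (Set.finite_singleton []).subset ?_
    rintro (_ | ⟨t, h⟩) hh
    · rfl
    · exact hh.elim
  | cons p w ih =>
    intro s
    have hfin : {t | IsStep p s t}.Finite := by
      refine (List.finite_length_le Bool (s.length + 2)).subset ?_
      rintro t ⟨l, r, x, y, _, rfl, rfl, hl⟩
      have hy : y.length ≤ 2 := by
        revert hl
        cases p.elem <;> simp only [IsLocal]
        · rintro ⟨_, b, rfl⟩; simp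
        · rintro ⟨rfl, _⟩; simp
        · rintro ⟨b, c, _, rfl⟩; simp
        · rintro ⟨b, _, rfl⟩; simp
      simp only [Set.mem_ofPred_eq, List.length_append]
      omega
    refine (hfin.biUnion fun t _ => (ih t).image (t :: ·)).subset ?_
    rintro (_ | ⟨t, h⟩) hh
    · exact hh.elim
    · exact Set.mem_biUnion (show t ∈ {t | IsStep p s t} from hh.1) ⟨h, hh.2, rfl⟩

noncomputable instance (G : GraphDiagram) : Fintype (HyperbolicOrientation G) :=
  (finite_isHyperbolic G.word []).fintype

end KauffmanVogel

/-! Weight an orientation of a diagram by `A` to the writhe and sum over all orientations. A diagram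
cut into slices makes this a transfer-operator computation: each piece acts on functions of the
directions of the strands (`transfer`), and `wordTransfer` composes these operators. Regular moves
and curls match orientations with equal boundary directions, and the signs change as the Dubrovnik
axioms for `a = A` require. The skein relation with `z = A - A⁻¹` is a linear identity between
operators, checked on the four directions of two strands. Half the sum is 1 on the circle, which has
two orientations, so this is a Dubrovnik polynomial (`isDubrovnik_orientationSum`).

For a vertex, crossing minus `A` times one smoothing minus `A⁻¹` times the other is again such an
operator: zero when the two lower ends are parallel, and `-A - A⁻¹` times the identity when they are
opposite (`transfer_vertex`). So expanding all vertices leaves exactly the hyperbolic orientations,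
with one factor `-A - A⁻¹` per vertex (`sum_states`, `sum_orientations`).

It remains to identify this function with the Dubrovnik polynomial, which needs uniqueness
(`IsDubrovnik.unique`); here `A ^ 2 ≠ 1` gives `z ≠ 0`. Let `D`, `D'` be two solutions that agree
below `N` crossings. At `N` crossings, the skein relation lets crossings be switched freely in the
question whether `D = D'`, and any bigon or curl reduces to fewer crossings. The lowest maximum is
then pushed down through the diagram: it slides past a piece, crosses one more strand, produces a
bigon or a curl, or cancels against a minimum, perhaps as a free circle (`of_longCap`). Cancelling
lowers the number of maxima, and a closed diagram without maxima is empty. Uniqueness also yields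
the specialisation statement, since the axioms are preserved by ring homomorphisms. -/

namespace KauffmanVogel

/-! ### The orientation sum as a vertex model, and its Dubrovnik axioms -/

section Transfer

variable {K : Type*} [Field K] (A : Kˣ)

/-- The transfer operator of a piece with no strand to its left: the weighted sum of `f` over the
directions above the piece that are compatible with the given directions below it. -/
def localTransfer (f : List Bool → K) : Elem → List Bool → K
  | .cup, s => f (true :: false :: s) + f (false :: true :: s)
  | .cap, b :: c :: s => if b = c then 0 else f s
  | .cross p, b :: c :: s => (if p = (b == c) then (A : K) else ((A⁻¹ : Kˣ) : K)) * f (c :: b :: s)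
  | .vertex, b :: c :: s => if b = c then 0 else (-(A : K) - ((A⁻¹ : Kˣ) : K)) * f (b :: c :: s)
  | _, _ => 0

/-- The transfer operator of a piece with `i` strands to its left. -/
def transfer (e : Elem) : ℕ → (List Bool → K) → List Bool → K
  | 0, f, s => localTransfer A f e s
  | i + 1, f, a :: s => transfer e i (fun t => f (a :: t)) s
  | _ + 1, _, [] => 0

/-- The transfer operator of a word. -/
def wordTransfer : List Piece → (List Bool → K) → List Bool → K
  | [], f => f
  | p :: w, f => transfer A p.elem p.left (wordTransfer w f)

theorem wordTransfer_append (u v : List Piece) (f : List Bool → K) :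
    wordTransfer A (u ++ v) f = wordTransfer A u (wordTransfer A v f) := by
  induction u with
  | nil => rfl
  | cons p u ih => simp [wordTransfer, ih]

theorem transfer_add (e : Elem) (i : ℕ) (f g : List Bool → K) (s : List Bool) :
    transfer A e i (fun t => f t + g t) s = transfer A e i f s + transfer A e i g s := by
  induction i generalizing f g s with
  | zero =>
    rcases e with _ | _ | p | _ <;> rcases s with _ | ⟨b, _ | ⟨c, s⟩⟩ <;>
      simp only [transfer, localTransfer, add_zero] <;> (try split_ifs) <;> ring
  | succ i ih =>
    rcases s with _ | ⟨a, s⟩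
    · simp [transfer]
    · exact ih _ _ _

theorem transfer_mul (e : Elem) (i : ℕ) (k : K) (f : List Bool → K) (s : List Bool) :
    transfer A e i (fun t => k * f t) s = k * transfer A e i f s := by
  induction i generalizing f s with
  | zero =>
    rcases e with _ | _ | p | _ <;> rcases s with _ | ⟨b, _ | ⟨c, s⟩⟩ <;>
      simp only [transfer, localTransfer, mul_zero] <;> (try split_ifs) <;> ring
  | succ i ih =>
    rcases s with _ | ⟨a, s⟩
    · simp [transfer]
    · exact ih _ _

theorem transfer_zero (e : Elem) (i : ℕ) (s : List Bool) :
    transfer A e i (fun _ => 0) s = 0 := by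
  simpa using transfer_mul A e i 0 (fun _ => 0) s

/-- Lists that are too short for a piece get the default value 0, so the local identities below hold
only on lists of sufficient length. This lemma and `wordTransfer_congr` allow them to be applied
above a word all the same. -/
theorem transfer_congr (e : Elem) (i : ℕ) (f g : List Bool → K) (s : List Bool)
    (h : ∀ t : List Bool, t.length + e.inWidth = s.length + e.outWidth → f t = g t) :
    transfer A e i f s = transfer A e i g s := by
  induction i generalizing f g s with
  | zero =>
    rcases e with _ | _ | p | _ <;> rcases s with _ | ⟨b, _ | ⟨c, s⟩⟩ <;>
      simp only [transfer, localTransfer]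
    all_goals
      first
      | rw [h, h] <;> simp [Elem.inWidth, Elem.outWidth]
      | rw [h]; simp [Elem.inWidth, Elem.outWidth]
  | succ i ih =>
    rcases s with _ | ⟨a, s⟩
    · rfl
    · refine ih _ _ _ fun t ht => h _ ?_
      simp only [List.length_cons]; omega

theorem wordTransfer_congr (w : List Piece) (n m : ℕ) (hw : IsTangle w n m)
    (f g : List Bool → K) (h : ∀ t : List Bool, t.length = m → f t = g t)
    (s : List Bool) (hs : s.length = n) : wordTransfer A w f s = wordTransfer A w g s := by
  induction w generalizing n s with
  | nil => exact h _ (hs.trans hw)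
  | cons p w ih =>
    obtain ⟨h1, h2⟩ := hw
    exact transfer_congr A _ _ _ _ _ fun t ht => ih _ h2 t (by omega)

theorem isTangle_append {u v : List Piece} {n k : ℕ} :
    IsTangle (u ++ v) n k ↔ ∃ m, IsTangle u n m ∧ IsTangle v m k := by
  induction u generalizing n with
  | nil => simp [IsTangle]
  | cons p u ih => simp [IsTangle, ih, and_assoc]

theorem wordTransfer_mul (w : List Piece) (k : K) (f : List Bool → K) (s : List Bool) :
    wordTransfer A w (fun t => k * f t) s = k * wordTransfer A w f s := by
  induction w generalizing s with
  | nil => rfl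
  | cons p w ih =>
    simp only [wordTransfer]
    rw [← transfer_mul]
    congr 1
    funext t
    exact ih t

theorem wordTransfer_add (w : List Piece) (f g : List Bool → K) (s : List Bool) :
    wordTransfer A w (fun t => f t + g t) s = wordTransfer A w f s + wordTransfer A w g s := by
  induction w generalizing s with
  | nil => rfl
  | cons p w ih =>
    simp only [wordTransfer]
    rw [← transfer_add]
    congr 1
    funext t
    exact ih t

/-- The two operators act on disjoint groups of strands and therefore commute. The strands to the
left of both are inert and are stripped by induction. -/
theorem transfer_exchange (x y : Elem) (i k : ℕ) (f : List Bool → K) (s : List Bool)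
    (hs : i + x.inWidth ≤ s.length) :
    transfer A x i (transfer A y (i + x.outWidth + k) f) s =
      transfer A y (i + x.inWidth + k) (transfer A x i f) s := by
  induction i generalizing f s with
  | zero =>
    rcases x with _ | _ | p | _
    · simp only [transfer, localTransfer, Elem.inWidth, Elem.outWidth, zero_add]
      rw [transfer_add, show 2 + k = k + 1 + 1 by ring]
      rfl
    all_goals
      rcases s with _ | ⟨b, _ | ⟨c, s⟩⟩ <;> try simp [Elem.inWidth] at hs
      simp only [Elem.inWidth, Elem.outWidth, zero_add]
      rw [show 2 + k = k + 1 + 1 by ring]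
      simp only [transfer, localTransfer]
      try split_ifs
      all_goals first | rw [transfer_zero] | rw [transfer_mul] | rfl
  | succ i ih =>
    rcases s with _ | ⟨a, s⟩
    · simp at hs
    · have e1 : i + 1 + x.outWidth + k = (i + x.outWidth + k) + 1 := by ring
      have e2 : i + 1 + x.inWidth + k = (i + x.inWidth + k) + 1 := by ring
      rw [e1, e2]
      simp only [transfer]
      exact ih _ _ (by simp at hs; omega)

/-- The orientations of the two sides of a move with the same boundary directions correspond, with
equal total sign. After stripping the strands on the left, this is a finite check on at most three
ends. -/
theorem wordTransfer_regularMove {p q : List Piece} (h : RegularMove p q) {n m : ℕ}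
    (hp : IsTangle p n m) (f : List Bool → K) (s : List Bool) (hs : s.length = n) :
    wordTransfer A p f s = wordTransfer A q f s := by
  subst hs
  cases h with
  | exchange x y i k => exact transfer_exchange A x y i k f s hp.1
  | zigzagRight i =>
    have h1 : i + 1 ≤ s.length := hp.1
    clear hp
    simp only [wordTransfer]
    induction i generalizing f s with
    | zero =>
      rcases s with _ | ⟨a, s⟩
      · simp at h1
      · cases a <;> simp [transfer, localTransfer]
    | succ i ih =>
      rcases s with _ | ⟨a, s⟩
      · simp at h1
      · exact ih (fun t => f (a :: t)) s (by simpa using h1)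
  | zigzagLeft i =>
    have h1 : i + 1 ≤ s.length := by
      have := hp.2.1
      simp [Elem.inWidth, Elem.outWidth] at this; omega
    clear hp
    simp only [wordTransfer]
    induction i generalizing f s with
    | zero =>
      rcases s with _ | ⟨a, s⟩
      · simp at h1
      · cases a <;> simp [transfer, localTransfer]
    | succ i ih =>
      rcases s with _ | ⟨a, s⟩
      · simp at h1
      · exact ih (fun t => f (a :: t)) s (by simpa using h1)
  | slideCup b i =>
    have h1 : i + 1 ≤ s.length := by
      have := hp.2.1
      simp [Elem.inWidth, Elem.outWidth] at this; omega
    clear hp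
    simp only [wordTransfer]
    induction i generalizing f s with
    | zero =>
      rcases s with _ | ⟨a, s⟩
      · simp at h1
      · cases a <;> cases b <;> simp [transfer, localTransfer]
    | succ i ih =>
      rcases s with _ | ⟨a, s⟩
      · simp at h1
      · exact ih (fun t => f (a :: t)) s (by simpa using h1)
  | slideCap b i =>
    have h1 : i + 3 ≤ s.length := by
      have := hp.2.1
      simp [Elem.inWidth, Elem.outWidth] at this; omega
    clear hp
    simp only [wordTransfer]
    induction i generalizing f s with
    | zero =>
      rcases s with _ | ⟨a, _ | ⟨c, _ | ⟨d, s⟩⟩⟩ <;> try simp at h1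
      cases a <;> cases b <;> cases c <;> cases d <;> simp [transfer, localTransfer]
    | succ i ih =>
      rcases s with _ | ⟨a, s⟩
      · simp at h1
      · exact ih (fun t => f (a :: t)) s (by simpa using h1)
  | reidemeister2 b i =>
    have h1 : i + 2 ≤ s.length := hp.1
    clear hp
    simp only [wordTransfer]
    induction i generalizing f s with
    | zero =>
      rcases s with _ | ⟨a, _ | ⟨c, s⟩⟩ <;> try simp at h1
      cases a <;> cases b <;> cases c <;> simp [transfer, localTransfer]
    | succ i ih =>
      rcases s with _ | ⟨a, s⟩
      · simp at h1
      · exact ih (fun t => f (a :: t)) s (by simpa using h1)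
  | reidemeister3 b i =>
    have h1 : i + 3 ≤ s.length := by
      have := hp.2.1
      simp [Elem.inWidth, Elem.outWidth] at this; omega
    clear hp
    simp only [wordTransfer]
    induction i generalizing f s with
    | zero =>
      rcases s with _ | ⟨a, _ | ⟨c, _ | ⟨d, s⟩⟩⟩ <;> try simp at h1
      cases a <;> cases b <;> cases c <;> cases d <;> simp [transfer, localTransfer]
    | succ i ih =>
      rcases s with _ | ⟨a, s⟩
      · simp at h1
      · exact ih (fun t => f (a :: t)) s (by simpa using h1)

/-- The direction of the strand extends in only one way through the curl, and the sign of a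
self-crossing does not depend on it. -/
theorem wordTransfer_isCurl {p : List Piece} {b : Bool} (h : IsCurl b p) {n m : ℕ}
    (hp : IsTangle p n m) (f : List Bool → K) (s : List Bool) (hs : s.length = n) :
    wordTransfer A p f s = (if b then (A : K) else ((A⁻¹ : Kˣ) : K)) * f s := by
  subst hs
  cases h with
  | right i =>
    have h1 : i + 1 ≤ s.length := hp.1
    clear hp
    simp only [wordTransfer]
    induction i generalizing f s with
    | zero =>
      rcases s with _ | ⟨a, s⟩
      · simp at h1
      · cases a <;> cases b <;> simp [transfer, localTransfer]
    | succ i ih =>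
      rcases s with _ | ⟨a, s⟩
      · simp at h1
      · exact ih (fun t => f (a :: t)) s (by simpa using h1)
  | left i =>
    have h1 : i + 1 ≤ s.length := by
      have := hp.2.1
      simp [Elem.inWidth, Elem.outWidth] at this; omega
    clear hp
    simp only [wordTransfer]
    induction i generalizing f s with
    | zero =>
      rcases s with _ | ⟨a, s⟩
      · simp at h1
      · cases a <;> cases b <;> simp [transfer, localTransfer]
    | succ i ih =>
      rcases s with _ | ⟨a, s⟩
      · simp at h1
      · exact ih (fun t => f (a :: t)) s (by simpa using h1)

/-- The skein relation as an operator identity. For parallel ends the term with `cap` vanishes and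
the weights differ by `A - A⁻¹`; for opposite ends the two unswapped terms cancel. -/
theorem transfer_cross_true (i : ℕ) (f : List Bool → K) (s : List Bool) (h : i + 2 ≤ s.length) :
    transfer A (.cross true) i f s = transfer A (.cross false) i f s +
      ((A : K) - ((A⁻¹ : Kˣ) : K)) * f s +
        -((A : K) - ((A⁻¹ : Kˣ) : K)) * transfer A .cap i (transfer A .cup i f) s := by
  induction i generalizing f s with
  | zero =>
    rcases s with _ | ⟨a, _ | ⟨c, s⟩⟩ <;> try simp at h
    cases a <;> cases c <;> simp [transfer, localTransfer] <;> ring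
  | succ i ih =>
    rcases s with _ | ⟨a, s⟩
    · simp at h
    · exact ih (fun t => f (a :: t)) s (by simp at h; omega)

/-- For parallel ends `A - A = 0`. For opposite ends the swapped terms `A⁻¹` cancel, and `-A - A⁻¹`
remains in front of the unswapped one: only hyperbolic directions survive. -/
theorem transfer_vertex (i : ℕ) (f : List Bool → K) (s : List Bool) (h : i + 2 ≤ s.length) :
    transfer A .vertex i f s = transfer A (.cross true) i f s + -(A : K) * f s +
        -((A⁻¹ : Kˣ) : K) * transfer A .cap i (transfer A .cup i f) s := by
  induction i generalizing f s with
  | zero =>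
    rcases s with _ | ⟨a, _ | ⟨c, s⟩⟩ <;> try simp at h
    cases a <;> cases c <;> simp [transfer, localTransfer] <;> ring
  | succ i ih =>
    rcases s with _ | ⟨a, s⟩
    · simp at h
    · exact ih (fun t => f (a :: t)) s (by simp at h; omega)

/-- Half the weighted number of orientations. -/
def orientationSum (w : List Piece) : K := 1 / 2 * wordTransfer A w (fun _ => 1) []

theorem isDubrovnik_orientationSum (h2 : (2 : K) ≠ 0) :
    IsDubrovnik ((A : K) - ((A⁻¹ : Kˣ) : K)) A (fun L => orientationSum A L.word) := by
  have key : ∀ (u p v : List Piece) (L : LinkDiagram), L.word = u ++ p ++ v →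
      ∃ n m, IsTangle u 0 n ∧ IsTangle p n m := by
    intro u p v L h
    have := L.closed
    rw [h, List.append_assoc, isTangle_append] at this
    obtain ⟨n, h1, h3⟩ := this
    obtain ⟨m, h3, h4⟩ := isTangle_append.1 h3
    exact ⟨n, m, h1, h3⟩
  have curl : ∀ (b : Bool) (u v p : List Piece) (L L' : LinkDiagram), IsCurl b p →
    L.word = u ++ p ++ v → L'.word = u ++ v →
      orientationSum A L.word =
        (if b then (A : K) else ((A⁻¹ : Kˣ) : K)) * orientationSum A L'.word := by
    intro b u v p L L' hc h h'
    obtain ⟨n, m, hu, hp⟩ := key u p v L h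
    rw [orientationSum, orientationSum, h, h', List.append_assoc, wordTransfer_append,
      wordTransfer_append, wordTransfer_append, mul_left_comm]
    congr 1
    rw [← wordTransfer_mul]
    exact wordTransfer_congr A u 0 n hu _ _
      (fun t ht => wordTransfer_isCurl A hc hp (wordTransfer A v fun _ => 1) t ht) [] rfl
  constructor
  · intro u v p q L L' hm h h'
    obtain ⟨n, m, hu, hp⟩ := key u p v L h
    simp only [orientationSum]
    rw [h, h', List.append_assoc, List.append_assoc]
    simp only [wordTransfer_append]
    congr 1
    exact wordTransfer_congr A u 0 n hu _ _
      (fun t ht => wordTransfer_regularMove A hm hp _ t ht) _ rfl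
  · intro u v p L L' hc h h'
    simpa using curl true u v p L L' hc h h'
  · intro u v p L L' hc h h'
    simpa using curl false u v p L L' hc h h'
  · intro u v i L₁ L₂ L₃ L₄ h1 h2 h3 h4
    obtain ⟨n, m, hu, hp⟩ := key u _ v L₁ h1
    simp only [orientationSum]
    rw [h1, h2, h3, h4, List.append_assoc, List.append_assoc, List.append_assoc]
    simp only [wordTransfer_append]
    have := wordTransfer_congr A u 0 n hu _ _ (fun t ht => transfer_cross_true A i
      (wordTransfer A v fun _ => 1) t (ht ▸ hp.1)) [] rfl
    rw [wordTransfer_add, wordTransfer_add, wordTransfer_mul, wordTransfer_mul] at this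
    simp only [wordTransfer]
    linear_combination 1 / 2 * this
  · intro L h
    -- The circle has two orientations of weight 1; this is what the factor one half normalises.
    simp only [orientationSum, h, wordTransfer, transfer, localTransfer]
    simp
    norm_num
    exact inv_mul_cancel₀ h2

end Transfer

/-! ### From transfer operators to sums over hyperbolic orientations and over states -/

section StateSum

/-- The directions above a piece with no strand to its left that are compatible with the given
directions below it. -/
def localSteps : Elem → List Bool → List (List Bool)
  | .cup, s => [true :: false :: s, false :: true :: s]
  | .cap, b :: c :: s => if b = c then [] else [s]
  | .cross _, b :: c :: s => [c :: b :: s]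
  | .vertex, b :: c :: s => if b = c then [] else [b :: c :: s]
  | _, _ => []

/-- The directions above a piece with `i` strands to its left that are compatible with the given
directions below it. -/
def steps (e : Elem) : ℕ → List Bool → List (List Bool)
  | 0, s => localSteps e s
  | i + 1, a :: s => (steps e i s).map (a :: ·)
  | _ + 1, [] => []

theorem isStep_zero (e : Elem) (s t : List Bool) :
    IsStep ⟨e, 0⟩ s t ↔ ∃ r x y, s = x ++ r ∧ t = y ++ r ∧ IsLocal e x y := by
  simp only [IsStep]
  constructor
  · rintro ⟨l, r, x, y, hl, rfl, rfl, h⟩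
    rw [List.length_eq_zero_iff] at hl
    subst hl
    exact ⟨r, x, y, rfl, rfl, h⟩
  · rintro ⟨r, x, y, rfl, rfl, h⟩
    exact ⟨[], r, x, y, rfl, rfl, rfl, h⟩

theorem isStep_succ_cons (e : Elem) (i : ℕ) (a : Bool) (s t : List Bool) :
    IsStep ⟨e, i + 1⟩ (a :: s) t ↔ ∃ t', IsStep ⟨e, i⟩ s t' ∧ a :: t' = t := by
  simp only [IsStep]
  constructor
  · rintro ⟨l, r, x, y, hl, hs, rfl, h⟩
    rcases l with _ | ⟨a', l⟩
    · simp at hl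
    · simp only [List.cons_append, List.cons.injEq] at hs
      obtain ⟨rfl, hs⟩ := hs
      exact ⟨_, ⟨l, r, x, y, by simpa using hl, hs, rfl, h⟩, rfl⟩
  · rintro ⟨t', ⟨l, r, x, y, hl, rfl, rfl, h⟩, rfl⟩
    exact ⟨a :: l, r, x, y, by simpa using hl, rfl, rfl, h⟩

theorem mem_steps (e : Elem) (i : ℕ) (s t : List Bool) :
    t ∈ steps e i s ↔ IsStep ⟨e, i⟩ s t := by
  induction i generalizing s t with
  | zero =>
    rw [isStep_zero, steps]
    constructor
    · intro h
      rcases e with _ | _ | p | _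
      · simp only [localSteps, List.mem_cons, List.not_mem_nil, or_false] at h
        rcases h with rfl | rfl
        · exact ⟨s, [], [true, false], rfl, rfl, rfl, true, rfl⟩
        · exact ⟨s, [], [false, true], rfl, rfl, rfl, false, rfl⟩
      all_goals
        rcases s with _ | ⟨b, _ | ⟨c, s⟩⟩ <;> simp [localSteps] at h
      · obtain ⟨h, rfl⟩ := h
        exact ⟨t, [b, c], [], rfl, rfl, rfl, b, by cases b <;> cases c <;> simp_all⟩
      · exact ⟨s, [b, c], [c, b], rfl, h, b, c, rfl, rfl⟩
      · obtain ⟨h, rfl⟩ := h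
        exact ⟨s, [b, c], [b, c], rfl, rfl, b, by cases b <;> cases c <;> simp_all⟩
    · rintro ⟨r, x, y, rfl, rfl, h⟩
      rcases e with _ | _ | p | _
      · obtain ⟨rfl, b, rfl⟩ := h
        cases b <;> simp [localSteps]
      · obtain ⟨rfl, b, rfl⟩ := h
        cases b <;> simp [localSteps]
      · obtain ⟨b, c, rfl, rfl⟩ := h
        simp [localSteps]
      · obtain ⟨b, rfl, rfl⟩ := h
        cases b <;> simp [localSteps]
  | succ i ih =>
    rcases s with _ | ⟨a, s⟩
    · simp [steps, IsStep]
    · simp [steps, isStep_succ_cons, ih]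

theorem nodup_steps (e : Elem) (i : ℕ) (s : List Bool) : (steps e i s).Nodup := by
  induction i generalizing s with
  | zero =>
    rcases e with _ | _ | p | _ <;> rcases s with _ | ⟨b, _ | ⟨c, s⟩⟩ <;>
      simp [steps, localSteps] <;> split_ifs <;> simp
  | succ i ih =>
    rcases s with _ | ⟨a, s⟩
    · simp [steps]
    · exact (ih s).map (by intro x y h; simpa using h)

variable {K : Type*} [Field K] (A : Kˣ)

theorem transfer_eq_sum_steps (e : Elem) (i : ℕ) (f : List Bool → K) (s : List Bool) :
    transfer A e i f s =
      (if e.isVertex then -(A : K) - ((A⁻¹ : Kˣ) : K) else 1) *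
        ((steps e i s).map fun t => ((A ^ sign ⟨e, i⟩ s : Kˣ) : K) * f t).sum := by
  induction i generalizing f s with
  | zero =>
    rcases e with _ | _ | p | _ <;> rcases s with _ | ⟨b, _ | ⟨c, s⟩⟩ <;>
      simp only [steps, localSteps, transfer, localTransfer, sign] <;> split_ifs <;>
      simp_all [Elem.isVertex]
  | succ i ih =>
    rcases s with _ | ⟨a, s⟩
    · simp [steps, transfer]
    · simp only [transfer, steps, ih, List.map_map]
      rfl

/-- The hyperbolic orientations of a word with given directions below it. -/
def orientations : List Piece → List Bool → List (List (List Bool))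
  | [], _ => [[]]
  | p :: w, s => (steps p.elem p.left s).flatMap fun t => (orientations w t).map (t :: ·)

theorem mem_orientations (w : List Piece) (s : List Bool) (h : List (List Bool)) :
    h ∈ orientations w s ↔ IsHyperbolic w s h := by
  induction w generalizing s h with
  | nil => cases h <;> simp [orientations, IsHyperbolic]
  | cons p w ih =>
    cases h with
    | nil => simp [orientations, IsHyperbolic]
    | cons t h => simp [orientations, IsHyperbolic, ih, mem_steps, and_comm]

theorem nodup_orientations (w : List Piece) (s : List Bool) : (orientations w s).Nodup := by
  induction w generalizing s with
  | nil => simp [orientations]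
  | cons p w ih =>
    rw [orientations, List.nodup_flatMap]
    refine ⟨fun t _ => (ih t).map (by intro x y h; simpa using h), ?_⟩
    refine (nodup_steps p.elem p.left s).imp ?_
    intro a b hab x hx hy
    simp only [List.mem_map] at hx hy
    obtain ⟨_, _, rfl⟩ := hx
    obtain ⟨_, _, h⟩ := hy
    exact hab (by simpa using (List.cons.inj h).1.symm)

/-- Expanding one slice at a time, the crossing weights multiply to `A` to the writhe, and each
vertex contributes a factor that is the same for all admissible directions. -/
theorem sum_orientations (w : List Piece) (s : List Bool) :
    wordTransfer A w (fun _ => 1) s =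
      (-(A : K) - ((A⁻¹ : Kˣ) : K)) ^ w.countP (fun p => p.elem.isVertex) *
        ((orientations w s).map fun h => ((A ^ writheAux w s h : Kˣ) : K)).sum := by
  induction w generalizing s with
  | nil => simp [wordTransfer, orientations, writheAux]
  | cons p w ih =>
    have hp : (-(A : K) - ((A⁻¹ : Kˣ) : K)) ^ (p :: w).countP (fun p => p.elem.isVertex) =
        (if p.elem.isVertex then -(A : K) - ((A⁻¹ : Kˣ) : K) else 1) *
          (-(A : K) - ((A⁻¹ : Kˣ) : K)) ^ w.countP (fun p => p.elem.isVertex) := by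
      rw [List.countP_cons]; split_ifs <;> ring
    rw [hp, wordTransfer, transfer_eq_sum_steps, mul_assoc, orientations, List.map_flatMap]
    congr 1
    rw [List.flatMap_def, List.sum_flatten, List.map_map, ← List.sum_map_mul_left]
    congr 1
    refine List.map_congr_left fun t _ => ?_
    rw [ih]
    simp only [Function.comp_def, List.map_map, writheAux, zpow_add, Units.val_mul,
      List.sum_map_mul_left]
    ring

theorem sum_writhe (G : GraphDiagram) :
    ∑ h : HyperbolicOrientation G, ((A ^ h.writhe : Kˣ) : K) =
      ((orientations G.word []).map fun h => ((A ^ writheAux G.word [] h : Kˣ) : K)).sum := by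
  rw [← List.sum_toFinset _ (nodup_orientations G.word [])]
  refine Finset.sum_bij (fun h _ => h.1) ?_ ?_ ?_ ?_
  · intro h _
    simpa [mem_orientations] using h.2
  · intro a _ b _ h
    exact Subtype.ext h
  · intro h hh
    refine ⟨⟨h, ?_⟩, Finset.mem_univ _, rfl⟩
    simpa [mem_orientations] using hh
  · intro h _
    rfl

/-- By linearity of the operators the vertices can be expanded one by one, each by
`transfer_vertex`. -/
theorem sum_states (w : List Piece) (n m : ℕ) (hw : IsTangle w n m) (f : List Bool → K)
    (s : List Bool) (hs : s.length = n) :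
    ((states (A : K) ((A⁻¹ : Kˣ) : K) w).map fun x => x.1 * wordTransfer A x.2 f s).sum =
      wordTransfer A w f s := by
  induction w generalizing n s with
  | nil => simp [states, wordTransfer]
  | cons p w ih =>
    obtain ⟨e, i⟩ := p
    obtain ⟨h1, h2⟩ := hw
    simp only at h1 h2
    -- With the local state `q` of the lowest piece fixed, the sum over the states of the rest
    -- passes inside the operator of `q`.
    have key : ∀ (q : List Piece), IsTangle q n (n - e.inWidth + e.outWidth) →
        ((states (A : K) ((A⁻¹ : Kˣ) : K) w).map
          fun x => x.1 * wordTransfer A (q ++ x.2) f s).sum =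
        wordTransfer A q (wordTransfer A w f) s := by
      intro q hq
      rw [← wordTransfer_congr A q _ _ hq _ _ (fun t ht => ih _ h2 t ht) s hs]
      generalize states (A : K) ((A⁻¹ : Kˣ) : K) w = l
      induction l with
      | nil =>
        simp only [List.map_nil, List.sum_nil]
        simpa using (wordTransfer_mul A q 0 (fun _ => 0) s).symm
      | cons x l ihl =>
        simp only [List.map_cons, List.sum_cons, ihl]
        rw [wordTransfer_add, wordTransfer_mul, wordTransfer_append]
    simp only [states, List.map_flatMap]
    simp only [List.flatMap_def, List.sum_flatten, List.map_map, Function.comp_def, mul_assoc,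
      List.sum_map_mul_left]
    have hsingle : IsTangle [⟨e, i⟩] n (n - e.inWidth + e.outWidth) := ⟨h1, rfl⟩
    rcases e with _ | _ | b | _
    · simpa [localStates, wordTransfer] using key _ hsingle
    · simpa [localStates, wordTransfer] using key _ hsingle
    · simpa [localStates, wordTransfer] using key _ hsingle
    · simp only [Elem.inWidth, Elem.outWidth] at h1 h2 key
      have e1 : n - 2 + 2 = n := by omega
      simp only [localStates, List.map_cons, List.map_nil, List.sum_cons, List.sum_nil]
      rw [key [cross true i] ⟨h1, rfl⟩, key [] e1.symm, key [cap i, cup i] ?_]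
      · simp only [wordTransfer]
        rw [transfer_vertex A i _ s (by omega)]
        ring
      · refine ⟨h1, ?_, rfl⟩
        simp [Elem.inWidth, Elem.outWidth]
        omega

theorem map_states {R S : Type*} [CommRing R] [CommRing S] (φ : R →+* S) (A' B' : R)
    (w : List Piece) :
    states (φ A') (φ B') w = (states A' B' w).map fun x => (φ x.1, x.2) := by
  induction w with
  | nil => simp [states]
  | cons p w ih =>
    obtain ⟨e, i⟩ := p
    cases e <;> simp [states, localStates, ih, Function.comp_def]

/-- A function of bare words in place of `D` removes the proofs attached to the states, so that the
sum can be manipulated as an ordinary list. -/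
theorem bracket_eq_sum_map {R : Type*} [CommRing R] (A' B' : R) (D : LinkDiagram → R)
    (F : List Piece → R) (hF : ∀ L : LinkDiagram, F L.word = D L) (G : GraphDiagram) :
    bracket A' B' D G = ((states A' B' G.word).map fun x => x.1 * F x.2).sum := by
  conv_rhs => rw [← List.attach_map_subtype_val (states A' B' G.word), List.map_map]
  rw [bracket]
  congr 1
  refine List.map_congr_left fun x _ => ?_
  simp [← hF, GraphDiagram.stateLink]

theorem bracket_orientationSum (G : GraphDiagram) :
    bracket (A : K) ((A⁻¹ : Kˣ) : K) (fun L => orientationSum A L.word) G =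
      1 / 2 * (-(A : K) - ((A⁻¹ : Kˣ) : K)) ^ G.numVertices *
        ∑ h : HyperbolicOrientation G, ((A ^ h.writhe : Kˣ) : K) := by
  rw [sum_writhe, mul_assoc, GraphDiagram.numVertices, ← sum_orientations,
    ← sum_states A G.word 0 0 G.closed _ [] rfl, ← List.sum_map_mul_left,
    bracket_eq_sum_map _ _ _ (orientationSum A) fun _ => rfl]
  congr 1
  refine List.map_congr_left fun x _ => ?_
  rw [orientationSum]
  ring

end StateSum

/-! ### Reduction of link diagrams modulo diagrams with fewer crossings -/

section Reduction

/-- Whether a piece is a crossing. -/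
def Elem.isCross : Elem → Bool
  | .cross _ => true
  | _ => false

/-- Whether a piece is a maximum. -/
def Elem.isCap : Elem → Bool
  | .cap => true
  | _ => false

/-- The number of crossings of a word. -/
def crossings (w : List Piece) : ℕ := w.countP fun p => p.elem.isCross

/-- The number of maxima of a word. -/
def caps (w : List Piece) : ℕ := w.countP fun p => p.elem.isCap

@[simp] theorem crossings_nil : crossings [] = 0 := rfl

@[simp] theorem crossings_cons (p : Piece) (w : List Piece) :
    crossings (p :: w) = crossings w + if p.elem.isCross then 1 else 0 := List.countP_cons

@[simp] theorem crossings_append (u v : List Piece) :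
    crossings (u ++ v) = crossings u + crossings v := List.countP_append

@[simp] theorem caps_nil : caps [] = 0 := rfl

@[simp] theorem caps_cons (p : Piece) (w : List Piece) :
    caps (p :: w) = caps w + if p.elem.isCap then 1 else 0 := List.countP_cons

@[simp] theorem caps_append (u v : List Piece) :
    caps (u ++ v) = caps u + caps v := List.countP_append

/-- A tangle without vertices. -/
def IsLinkTangle (w : List Piece) (n m : ℕ) : Prop :=
  IsTangle w n m ∧ ∀ p ∈ w, p.elem ≠ .vertex

@[simp] theorem isLinkTangle_nil {n m : ℕ} : IsLinkTangle [] n m ↔ n = m := by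
  simp [IsLinkTangle, IsTangle]

@[simp] theorem isLinkTangle_cons {p : Piece} {w : List Piece} {n m : ℕ} :
    IsLinkTangle (p :: w) n m ↔ p.elem ≠ .vertex ∧ p.left + p.elem.inWidth ≤ n ∧
      IsLinkTangle w (n - p.elem.inWidth + p.elem.outWidth) m := by
  simp only [IsLinkTangle, IsTangle, List.mem_cons, forall_eq_or_imp]
  tauto

theorem isLinkTangle_append {u v : List Piece} {n k : ℕ} :
    IsLinkTangle (u ++ v) n k ↔ ∃ m, IsLinkTangle u n m ∧ IsLinkTangle v m k := by
  simp only [IsLinkTangle, isTangle_append, List.mem_append, or_imp, forall_and]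
  constructor
  · rintro ⟨⟨m, h1, h2⟩, h3, h4⟩
    exact ⟨m, ⟨h1, h3⟩, h2, h4⟩
  · rintro ⟨m, ⟨h1, h3⟩, h2, h4⟩
    exact ⟨⟨m, h1, h2⟩, h3, h4⟩

/-- The properties of a predicate `P` on words that allow to prove it for all closed link diagrams
with at most `N` crossings, once it is known for fewer than `N` crossings. -/
structure IsReductive (P : List Piece → Prop) (N : ℕ) : Prop where
  nil : P []
  move : ∀ (p q : List Piece), RegularMove p q → ∀ u v : List Piece,
    IsLinkTangle (u ++ (p ++ v)) 0 0 → IsLinkTangle (u ++ (q ++ v)) 0 0 →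
      (P (u ++ (p ++ v)) ↔ P (u ++ (q ++ v)))
  switch : ∀ (i : ℕ) (u v : List Piece), IsLinkTangle (u ++ cross true i :: v) 0 0 →
    crossings (u ++ cross true i :: v) ≤ N →
      (P (u ++ cross true i :: v) ↔ P (u ++ cross false i :: v))
  bigon : ∀ (i : ℕ) (u v : List Piece),
    IsLinkTangle (u ++ cross true i :: cross false i :: v) 0 0 →
      crossings (u ++ cross true i :: cross false i :: v) ≤ N →
        P (u ++ cross true i :: cross false i :: v)
  curl : ∀ (i : ℕ) (u v : List Piece),
    IsLinkTangle (u ++ cup i :: cross true (i + 1) :: cap i :: v) 0 0 →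
      crossings (u ++ cup i :: cross true (i + 1) :: cap i :: v) ≤ N →
        P (u ++ cup i :: cross true (i + 1) :: cap i :: v)
  circle : ∀ (i : ℕ) (u v : List Piece), IsLinkTangle (u ++ cup i :: cap i :: v) 0 0 →
    caps u = 0 → P (u ++ v) → P (u ++ cup i :: cap i :: v)

variable {P : List Piece → Prop} {N : ℕ}

/-- `p` and `q` may be exchanged at width `n` in the diagrams with at most `N` crossings. -/
structure Sim (P : List Piece → Prop) (N n : ℕ) (p q : List Piece) : Prop where
  tangle : ∀ m, IsLinkTangle p n m ↔ IsLinkTangle q n m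
  crossings_eq : crossings p = crossings q
  iff : ∀ u v, IsLinkTangle u 0 n → IsLinkTangle (p ++ v) n 0 →
    crossings (u ++ (p ++ v)) ≤ N → (P (u ++ (p ++ v)) ↔ P (u ++ (q ++ v)))

/-- `P` holds for all diagrams with at most `N` crossings that contain `p` at width `n`. -/
def Vanish (P : List Piece → Prop) (N n : ℕ) (p : List Piece) : Prop :=
  ∀ u v, IsLinkTangle u 0 n → IsLinkTangle (p ++ v) n 0 →
    crossings (u ++ (p ++ v)) ≤ N → P (u ++ (p ++ v))

theorem Sim.append_tangle {n : ℕ} {p q : List Piece} (h : Sim P N n p q) (r : List Piece) (m : ℕ) :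
    IsLinkTangle (p ++ r) n m ↔ IsLinkTangle (q ++ r) n m := by
  simp only [isLinkTangle_append, h.tangle]

theorem Sim.refl (n : ℕ) (p : List Piece) : Sim P N n p p :=
  ⟨fun _ => Iff.rfl, rfl, fun _ _ _ _ _ => Iff.rfl⟩

theorem Sim.symm {n : ℕ} {p q : List Piece} (h : Sim P N n p q) : Sim P N n q p :=
  ⟨fun m => (h.tangle m).symm, h.crossings_eq.symm, fun u v hu hv hc =>
    (h.iff u v hu ((h.append_tangle v 0).2 hv)
      (by simpa [h.crossings_eq] using hc)).symm⟩

theorem Sim.trans {n : ℕ} {p q r : List Piece} (h : Sim P N n p q) (h' : Sim P N n q r) :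
    Sim P N n p r :=
  ⟨fun m => (h.tangle m).trans (h'.tangle m), h.crossings_eq.trans h'.crossings_eq,
    fun u v hu hv hc => (h.iff u v hu hv hc).trans
      (h'.iff u v hu ((h.append_tangle v 0).1 hv) (by simpa [h.crossings_eq] using hc))⟩

theorem Sim.append {n : ℕ} {p q : List Piece} (h : Sim P N n p q) (r : List Piece) :
    Sim P N n (p ++ r) (q ++ r) :=
  ⟨fun m => h.append_tangle r m, by simp [h.crossings_eq], fun u v hu hv hc => by
    rw [List.append_assoc] at *
    rw [List.append_assoc]
    exact h.iff u (r ++ v) hu hv hc⟩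

theorem Sim.cons (x : Piece) {n : ℕ} {p q : List Piece}
    (h : Sim P N (n - x.elem.inWidth + x.elem.outWidth) p q) :
    Sim P N n (x :: p) (x :: q) := by
  refine ⟨fun m => by simp [h.tangle], by simp [h.crossings_eq], fun u v hu hv hc => ?_⟩
  have := h.iff (u ++ [x]) v
  simp only [List.append_assoc, List.singleton_append] at this
  rw [List.cons_append, isLinkTangle_cons] at hv
  exact this (isLinkTangle_append.2 ⟨n, hu, by simp [hv.1, hv.2.1]⟩) hv.2.2 hc

theorem Sim.vanish {n : ℕ} {p q : List Piece} (h : Sim P N n p q) (h' : Vanish P N n q) :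
    Vanish P N n p := fun u v hu hv hc =>
  (h.iff u v hu hv hc).2 (h' u v hu ((h.append_tangle v 0).1 hv)
    (by simpa [h.crossings_eq] using hc))

theorem Vanish.append {n : ℕ} {p : List Piece} (h : Vanish P N n p) (r : List Piece) :
    Vanish P N n (p ++ r) := fun u v hu hv hc => by
  rw [List.append_assoc] at *
  exact h u (r ++ v) hu hv hc

theorem Vanish.cons (x : Piece) {n : ℕ} {p : List Piece}
    (h : Vanish P N (n - x.elem.inWidth + x.elem.outWidth) p) :
    Vanish P N n (x :: p) := fun u v hu hv hc => by
  have := h (u ++ [x]) v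
  simp only [List.append_assoc, List.singleton_append] at this
  rw [List.cons_append, isLinkTangle_cons] at hv
  exact this (isLinkTangle_append.2 ⟨n, hu, by simp [hv.1, hv.2.1]⟩) hv.2.2 hc

/-! ### Local moves when crossing signs are immaterial -/

namespace IsReductive

theorem sim_of_move (h : IsReductive P N) {n : ℕ} {p q : List Piece} (hm : RegularMove p q)
    (ht : ∀ m, IsLinkTangle p n m ↔ IsLinkTangle q n m) (hc : crossings p = crossings q) :
    Sim P N n p q := by
  refine ⟨ht, hc, fun u v hu hv _ => h.move p q hm u v ?_ ?_⟩
  · exact isLinkTangle_append.2 ⟨n, hu, hv⟩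
  · refine isLinkTangle_append.2 ⟨n, hu, ?_⟩
    simpa only [isLinkTangle_append, ht] using hv

theorem sim_exchange (h : IsReductive P N) (n : ℕ) (x y : Elem) (i k : ℕ) :
    Sim P N n [⟨x, i⟩, ⟨y, i + x.outWidth + k⟩] [⟨y, i + x.inWidth + k⟩, ⟨x, i⟩] := by
  refine h.sim_of_move (.exchange x y i k) (fun m => ?_) (by simp; ring)
  simp only [isLinkTangle_cons, isLinkTangle_nil]
  have hx : x.inWidth ≤ 2 := by cases x <;> simp [Elem.inWidth]
  constructor
  · rintro ⟨h1, h2, h3, h4, h5⟩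
    exact ⟨h3, by omega, h1, by omega, by omega⟩
  · rintro ⟨h1, h2, h3, h4, h5⟩
    exact ⟨h3, by omega, h1, by omega, by omega⟩

theorem sim_zigzagRight (h : IsReductive P N) {n i : ℕ} (hi : i + 1 ≤ n) :
    Sim P N n [cup (i + 1), cap i] [] := by
  refine h.sim_of_move (.zigzagRight i) (fun m => ?_) rfl
  simp [Elem.inWidth, Elem.outWidth]; omega

theorem sim_zigzagLeft (h : IsReductive P N) {n i : ℕ} (hi : i + 1 ≤ n) :
    Sim P N n [cup i, cap (i + 1)] [] := by
  refine h.sim_of_move (.zigzagLeft i) (fun m => ?_) rfl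
  simp [Elem.inWidth, Elem.outWidth]; omega

/-- Every crossing may be replaced by `cross true`, so from here on only the shadow of a diagram
matters. -/
theorem sim_switch (h : IsReductive P N) (n i : ℕ) (b : Bool) :
    Sim P N n [cross b i] [cross true i] := by
  cases b
  · refine Sim.symm ⟨fun m => by simp [Elem.inWidth, Elem.outWidth], rfl, fun u v hu hv hc => ?_⟩
    exact h.switch i u v (isLinkTangle_append.2 ⟨n, hu, hv⟩) hc
  · exact Sim.refl _ _

theorem sim_slideCup (h : IsReductive P N) (n i : ℕ) :
    Sim P N n [cup i, cross true (i + 1)] [cup (i + 1), cross true i] := by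
  have h1 : Sim P N n [cup i, cross true (i + 1)] [cup (i + 1), cross false i] := by
    refine h.sim_of_move (.slideCup true i) (fun m => ?_) rfl
    simp [Elem.inWidth, Elem.outWidth]; omega
  exact h1.trans (.cons _ (h.sim_switch _ _ _))

theorem sim_slideCap (h : IsReductive P N) (n i : ℕ) :
    Sim P N n [cross true i, cap (i + 1)] [cross true (i + 1), cap i] := by
  have h1 : Sim P N n [cross true i, cap (i + 1)] [cross false (i + 1), cap i] := by
    refine h.sim_of_move (.slideCap true i) (fun m => ?_) rfl
    simp [Elem.inWidth, Elem.outWidth]; omega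
  exact h1.trans ((h.sim_switch _ _ _).append [_])

theorem sim_braid (h : IsReductive P N) (n i : ℕ) :
    Sim P N n [cross true i, cross true (i + 1), cross true i]
      [cross true (i + 1), cross true i, cross true (i + 1)] := by
  refine h.sim_of_move (.reidemeister3 true i) (fun m => ?_) rfl
  simp [Elem.inWidth, Elem.outWidth]; omega

/-- Two equal crossings form a clasp, to which the second Reidemeister move does not apply;
switching one of them makes it applicable. -/
theorem vanish_bigon (h : IsReductive P N) (n i : ℕ) :
    Vanish P N n [cross true i, cross true i] := by
  refine Sim.vanish (.cons _ (h.sim_switch _ _ false).symm) fun u v hu hv hc => ?_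
  exact h.bigon i u v (isLinkTangle_append.2 ⟨n, hu, hv⟩) hc

theorem vanish_curl (h : IsReductive P N) (n i : ℕ) :
    Vanish P N n [cup i, cross true (i + 1), cap i] := fun u v hu hv hc =>
  h.curl i u v (isLinkTangle_append.2 ⟨n, hu, hv⟩) hc

/-- A twisted maximum. -/
theorem vanish_cross_cap (h : IsReductive P N) (n i : ℕ) :
    Vanish P N n [cross true i, cap i] := by
  intro u v hu hv hc
  have hn : i + 2 ≤ n := by simpa [Elem.inWidth] using hv.1.1
  refine (?_ : Vanish P N n [cross true i, cap i]) u v hu hv hc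
  -- A zigzag is inserted in the strand to the right of the loop. After height exchanges its minimum
  -- slides through the crossing, and a left curl below a maximum appears.
  have s1 : Sim P N n [cup (i + 1), cap (i + 2), cross true i, cap i] [cross true i, cap i] :=
    (h.sim_zigzagLeft (i := i + 1) (by omega)).append _
  have s2 : Sim P N n [cup (i + 1), cross true i, cap (i + 2), cap i]
      [cup (i + 1), cap (i + 2), cross true i, cap i] :=
    .cons _ ((h.sim_exchange _ (.cross true) .cap i 0).append [cap i])
  have s3 : Sim P N n [cup (i + 1), cross true i, cap i, cap i]
      [cup (i + 1), cross true i, cap (i + 2), cap i] :=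
    .cons _ (.cons _ (h.sim_exchange _ .cap .cap i 0))
  have s4 : Sim P N n [cup i, cross true (i + 1), cap i, cap i]
      [cup (i + 1), cross true i, cap i, cap i] :=
    (h.sim_slideCup _ i).append _
  exact (((s4.trans s3).trans s2).trans s1).symm.vanish ((h.vanish_curl _ i).append [cap i])

/-- A twisted minimum. -/
theorem vanish_cup_cross (h : IsReductive P N) (n i : ℕ) :
    Vanish P N n [cup i, cross true i] := by
  intro u v hu hv hc
  have hn : i ≤ n := by simpa [Elem.inWidth] using hv.1.1
  refine (?_ : Vanish P N n [cup i, cross true i]) u v hu hv hc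
  -- The mirror argument: a zigzag above the twisted minimum, whose maximum slides through the
  -- crossing and leaves a left curl above a minimum.
  have s1 : Sim P N n [cup i, cross true i, cup (i + 2), cap (i + 1)] [cup i, cross true i] :=
    .cons _ (.cons _ (h.sim_zigzagRight (i := i + 1)
      (by simp [Elem.inWidth, Elem.outWidth]; omega)))
  have s2 : Sim P N n [cup i, cross true i, cup (i + 2), cap (i + 1)]
      [cup i, cup (i + 2), cross true i, cap (i + 1)] :=
    .cons _ ((h.sim_exchange _ (.cross true) .cup i 0).append [cap (i + 1)])
  have s3 : Sim P N n [cup i, cup (i + 2), cross true i, cap (i + 1)]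
      [cup i, cup i, cross true i, cap (i + 1)] :=
    (h.sim_exchange _ .cup .cup i 0).append [cross true i, cap (i + 1)]
  have s4 : Sim P N n [cup i, cup i, cross true i, cap (i + 1)]
      [cup i, cup i, cross true (i + 1), cap i] :=
    .cons _ (.cons _ (h.sim_slideCap _ i))
  exact (((s1.symm.trans s2).trans s3).trans s4).vanish (.cons _ (h.vanish_curl _ i))

end IsReductive

/-- A maximum that joins the strand `i` with the strand `i + d + 1` and crosses the `d` strands
between them. -/
def longCap : ℕ → ℕ → List Piece
  | i, 0 => [cap i]
  | i, d + 1 => cross true i :: longCap (i + 1) d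

theorem isLinkTangle_longCap {i d n m : ℕ} (h : IsLinkTangle (longCap i d) n m) :
    i + d + 2 ≤ n ∧ n - 2 = m := by
  induction d generalizing i n with
  | zero =>
    simp [longCap, Elem.inWidth, Elem.outWidth] at h
    omega
  | succ d ih =>
    simp only [longCap, isLinkTangle_cons] at h
    have := ih h.2.2
    simp only [Elem.inWidth, Elem.outWidth] at this h
    omega

/-! ### Pushing the lowest maximum down -/

namespace IsReductive

/-- A piece slides past a crossing to its left. -/
theorem sim_cross_comm (h : IsReductive P N) (n : ℕ) (e : Elem) (i k : ℕ) (r : List Piece) :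
    Sim P N n (⟨e, i + 2 + k⟩ :: cross true i :: r) (cross true i :: ⟨e, i + 2 + k⟩ :: r) :=
  (h.sim_exchange n (.cross true) e i k).symm.append r

theorem sim_longCap_left (h : IsReductive P N) (n : ℕ) (e : Elem) (j k d : ℕ) :
    Sim P N n (⟨e, j⟩ :: longCap (j + e.outWidth + k) d)
      (longCap (j + e.inWidth + k) d ++ [⟨e, j⟩]) := by
  induction d generalizing n k with
  | zero => exact h.sim_exchange n e .cap j k
  | succ d ih =>
    exact ((h.sim_exchange n e (.cross true) j k).append _).trans (.cons _ (ih _ (k + 1)))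

theorem sim_longCap_right (h : IsReductive P N) (n : ℕ) (e : Elem) (i k d : ℕ) :
    Sim P N n (⟨e, i + d + 2 + k⟩ :: longCap i d) (longCap i d ++ [⟨e, i + d + k⟩]) := by
  induction d generalizing n i with
  | zero => exact (h.sim_exchange n .cap e i k).symm
  | succ d ih =>
    rw [show i + (d + 1) + 2 + k = i + 2 + (d + 1 + k) by ring]
    refine (h.sim_cross_comm n e i _ _).trans (.cons _ ?_)
    have := ih (n - 2 + 2) (i + 1)
    rwa [show i + 1 + d + 2 + k = i + 2 + (d + 1 + k) by ring,
      show i + 1 + d + k = i + (d + 1) + k by ring] at this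

/-- The crossing sits on the right leg of the maximum and slides over its top to the left leg, where
`longCap` collects all its crossings. -/
theorem sim_longCap_extend (h : IsReductive P N) (n i d : ℕ) :
    Sim P N n (cross true (i + d + 1) :: longCap i d) (longCap i (d + 1)) := by
  induction d generalizing n i with
  | zero => exact (h.sim_slideCap n i).symm
  | succ d ih =>
    rw [show i + (d + 1) + 1 = i + 2 + d by ring]
    refine (h.sim_cross_comm n _ i _ _).trans (.cons _ ?_)
    have := ih (n - 2 + 2) (i + 1)
    rwa [show i + 1 + d + 1 = i + 2 + d by ring] at this

/-- The right leg crosses the last of the strands that the maximum crosses anyway, so the two curves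
bound a bigon. -/
theorem vanish_cross_longCap_right (h : IsReductive P N) (n i d : ℕ) :
    Vanish P N n (cross true (i + d + 1) :: longCap i (d + 1)) := by
  induction d generalizing n i with
  | zero =>
    exact (Sim.cons _ (h.sim_slideCap _ i)).vanish ((h.vanish_bigon n (i + 1)).append [cap i])
  | succ d ih =>
    rw [show i + (d + 1) + 1 = i + 2 + d by ring]
    refine (h.sim_cross_comm n _ i _ _).vanish (.cons _ ?_)
    have := ih (n - 2 + 2) (i + 1)
    rwa [show i + 1 + d + 1 = i + 2 + d by ring] at this

/-- The maximum crosses both strands of the crossing and passes over it by a third Reidemeister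
move. -/
theorem sim_cross_longCap_middle (h : IsReductive P N) (n i a b : ℕ) :
    Sim P N n (cross true (i + 1 + a) :: longCap i (a + 2 + b))
      (longCap i (a + 2 + b) ++ [cross true (i + a)]) := by
  induction a generalizing n i with
  | zero =>
    rw [show 0 + 2 + b = b + 1 + 1 by ring]
    refine ((h.sim_braid n i).symm.append (longCap (i + 2) b)).trans (.cons _ (.cons _ ?_))
    exact h.sim_longCap_left _ (.cross true) i 0 b
  | succ a ih =>
    rw [show a + 1 + 2 + b = a + 2 + b + 1 by ring, show i + 1 + (a + 1) = i + 2 + a by ring]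
    refine (h.sim_cross_comm n _ i _ _).trans (.cons _ ?_)
    have := ih (n - 2 + 2) (i + 1)
    rwa [show i + 1 + 1 + a = i + 2 + a by ring, show i + 1 + a = i + (a + 1) by ring] at this

/-- The right leg of the minimum is the left leg of the maximum. The two straighten to one strand
that still crosses the `d` strands, and no maximum is left. -/
theorem sim_cup_longCap_left (h : IsReductive P N) (n i d : ℕ) (hn : i + d + 1 ≤ n) :
    ∃ q, caps q = 0 ∧ Sim P N n (cup i :: longCap (i + 1) d) q := by
  induction d generalizing n i with
  | zero => exact ⟨[], rfl, h.sim_zigzagLeft (by omega)⟩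
  | succ d ih =>
    obtain ⟨q, hq, hs⟩ := ih n (i + 1) (by omega)
    refine ⟨q ++ [cross true i], by simp [hq, Elem.isCap], ?_⟩
    refine ((h.sim_slideCup n i).append (longCap (i + 2) d)).trans (.trans ?_ (hs.append _))
    exact .cons _ (h.sim_longCap_left _ (.cross true) i 0 d)

/-- The maximum crosses both legs of the minimum, which gives a bigon. -/
theorem vanish_cup_longCap_middle (h : IsReductive P N) (n i a b : ℕ) :
    Vanish P N n (cup (i + 1 + a) :: longCap i (a + 2 + b)) := by
  induction a generalizing n i with
  | zero =>
    rw [show 0 + 2 + b = b + 1 + 1 by ring]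
    refine ((h.sim_slideCup n i).symm.append (cross true (i + 1) :: longCap (i + 2) b)).vanish ?_
    exact .cons _ ((h.vanish_bigon _ (i + 1)).append _)
  | succ a ih =>
    rw [show a + 1 + 2 + b = a + 2 + b + 1 by ring, show i + 1 + (a + 1) = i + 2 + a by ring]
    refine (h.sim_cross_comm n _ i _ _).vanish (.cons _ ?_)
    have := ih (n - 2 + 2) (i + 1)
    rwa [show i + 1 + 1 + a = i + 2 + a by ring] at this

/-- The minimum continues the right leg of the maximum and its other leg is crossed by the same
maximum: a twisted minimum after sliding the crossing to the right leg. -/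
theorem vanish_cup_longCap_right (h : IsReductive P N) (n i d : ℕ) :
    Vanish P N n (cup (i + d + 1) :: longCap i (d + 1)) := by
  induction d generalizing n i with
  | zero =>
    exact (Sim.cons _ (h.sim_slideCap _ i)).vanish ((h.vanish_cup_cross n (i + 1)).append [cap i])
  | succ d ih =>
    rw [show i + (d + 1) + 1 = i + 2 + d by ring]
    refine (h.sim_cross_comm n _ i _ _).vanish (.cons _ ?_)
    have := ih (n - 2 + 2) (i + 1)
    rwa [show i + 1 + d + 1 = i + 2 + d by ring] at this

theorem sim_cup_longCap_right (h : IsReductive P N) (n i d : ℕ) (hn : i + d + 1 ≤ n) :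
    ∃ q, caps q = 0 ∧ Sim P N n (cup (i + d + 1) :: longCap i d) q := by
  induction d generalizing n i with
  | zero => exact ⟨[], rfl, h.sim_zigzagRight hn⟩
  | succ d ih =>
    rw [show i + (d + 1) + 1 = i + 2 + d by ring]
    obtain ⟨q, hq, hs⟩ := ih (n - 2 + 2) (i + 1) (by omega)
    refine ⟨cross true i :: q, by simp [hq, Elem.isCap], ?_⟩
    refine (h.sim_cross_comm n _ i _ _).trans (.cons _ ?_)
    rwa [show i + 1 + d + 1 = i + 2 + d by ring] at hs

/-- Induction on the part `u` below the maximum, which has only minima and crossings. The position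
of its top piece relative to the legs `i` and `i + d + 1` decides between sliding past, absorbing a
crossing, a bigon or curl, and cancellation. The crossing number never grows, and after a
cancellation `c` maxima remain. -/
theorem of_longCap (h : IsReductive P N) {c : ℕ}
    (hc : ∀ w, IsLinkTangle w 0 0 → crossings w ≤ N → caps w = c → P w) (u : List Piece) :
    ∀ (i d : ℕ) (v : List Piece), caps u = 0 → caps v = c →
      IsLinkTangle (u ++ (longCap i d ++ v)) 0 0 → crossings (u ++ (longCap i d ++ v)) ≤ N →
        P (u ++ (longCap i d ++ v)) := by
  induction u using List.reverseRecOn with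
  | nil =>
    -- The maximum cannot reach the bottom, where there are no strands.
    intro i d v _ _ ht _
    rw [List.nil_append] at ht
    obtain ⟨m, h1, _⟩ := isLinkTangle_append.1 ht
    have := (isLinkTangle_longCap h1).1
    omega
  | append_singleton u p ih =>
    intro i d v hu hv ht hN
    obtain ⟨e, j⟩ := p
    simp only [caps_append, caps_cons, caps_nil, zero_add, Nat.add_eq_zero_iff] at hu
    obtain ⟨hu, he⟩ := hu
    rw [List.append_assoc, List.singleton_append] at ht hN ⊢
    obtain ⟨n, htu, htp⟩ := isLinkTangle_append.1 ht
    have hw := htp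
    rw [isLinkTangle_cons] at hw
    obtain ⟨hev, hjn, hw⟩ := hw
    obtain ⟨m, hw, hvt⟩ := isLinkTangle_append.1 hw
    obtain ⟨hlen, rfl⟩ := isLinkTangle_longCap hw
    have via : ∀ r, Sim P N n (⟨e, j⟩ :: longCap i d) r → P (u ++ (r ++ v)) →
        P (u ++ ⟨e, j⟩ :: (longCap i d ++ v)) := fun r hs hr => (hs.iff u v htu htp hN).2 hr
    have transport : ∀ r, Sim P N n (⟨e, j⟩ :: longCap i d) r →
        IsLinkTangle (u ++ (r ++ v)) 0 0 ∧ crossings (u ++ (r ++ v)) ≤ N := by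
      intro r hs
      refine ⟨isLinkTangle_append.2 ⟨n, htu, (hs.append_tangle v 0).1 htp⟩, ?_⟩
      have := hs.crossings_eq
      simp only [crossings_append, crossings_cons] at this hN ⊢
      omega
    have slide : ∀ i' d' e' j', caps [(⟨e', j'⟩ : Piece)] = 0 →
        Sim P N n (⟨e, j⟩ :: longCap i d) (longCap i' d' ++ [⟨e', j'⟩]) →
        P (u ++ ⟨e, j⟩ :: (longCap i d ++ v)) := by
      intro i' d' e' j' hcap hs
      refine via _ hs ?_
      obtain ⟨h1, h2⟩ := transport _ hs
      rw [List.append_assoc] at h1 h2 ⊢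
      refine ih i' d' _ hu ?_ h1 h2
      rw [caps_append, hcap, hv, zero_add]
    have absorb : ∀ i' d', Sim P N n (⟨e, j⟩ :: longCap i d) (longCap i' d') →
        P (u ++ ⟨e, j⟩ :: (longCap i d ++ v)) := by
      intro i' d' hs
      obtain ⟨h1, h2⟩ := transport _ hs
      exact via _ hs (ih i' d' v hu hv h1 h2)
    have remove : (∃ q, caps q = 0 ∧ Sim P N n (⟨e, j⟩ :: longCap i d) q) →
        P (u ++ ⟨e, j⟩ :: (longCap i d ++ v)) := by
      rintro ⟨q, hq, hs⟩
      obtain ⟨h1, h2⟩ := transport _ hs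
      exact via _ hs (hc _ h1 h2 (by simp [hu, hq, hv]))
    have vanish : Vanish P N n (⟨e, j⟩ :: longCap i d) →
        P (u ++ ⟨e, j⟩ :: (longCap i d ++ v)) := fun hs => hs u v htu htp hN
    rcases e with _ | _ | b | _
    · replace hjn : j + 0 ≤ n := hjn
      replace hlen : i + d + 2 ≤ n - 0 + 2 := hlen
      by_cases c1 : j + 2 ≤ i
      · obtain ⟨k, rfl⟩ := Nat.exists_eq_add_of_le c1
        exact slide _ _ .cup j rfl (h.sim_longCap_left n .cup j k d)
      by_cases c2 : j + 1 = i
      · subst c2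
        exact remove (h.sim_cup_longCap_left n j d (by omega))
      by_cases c3 : j = i
      · subst c3
        rcases d with _ | d
        -- Both legs meet and nothing lies between them: a free circle, whose removal also removes
        -- the maximum.
        · refine h.circle j u v ht hu (hc _ ?_ ?_ ?_)
          · refine isLinkTangle_append.2 ⟨n, htu, ?_⟩
            simpa [Elem.inWidth, Elem.outWidth] using hvt
          · simp only [crossings_append, crossings_cons] at hN ⊢
            omega
          · simp [hu, hv]
        · exact vanish ((h.vanish_cup_cross n j).append _)
      by_cases c4 : j + 1 ≤ i + d
      · obtain ⟨a, rfl⟩ := Nat.exists_eq_add_of_le (show i + 1 ≤ j by omega)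
        obtain ⟨b, rfl⟩ := Nat.exists_eq_add_of_le (show a + 2 ≤ d by omega)
        exact vanish (h.vanish_cup_longCap_middle n i a b)
      by_cases c6 : j = i + d
      · subst c6
        obtain ⟨d, rfl⟩ := Nat.exists_eq_add_of_le' (show 1 ≤ d by omega)
        exact vanish (h.vanish_cup_longCap_right n i d)
      by_cases c7 : j = i + d + 1
      · subst c7
        exact remove (h.sim_cup_longCap_right n i d (by omega))
      obtain ⟨k, rfl⟩ := Nat.exists_eq_add_of_le (show i + d + 2 ≤ j by omega)
      exact slide _ _ .cup _ rfl (h.sim_longCap_right n .cup i k d)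
    · simp [Elem.isCap] at he
    · have sw : Sim P N n (cross b j :: longCap i d) (cross true j :: longCap i d) :=
        (h.sim_switch n j b).append _
      by_cases c1 : j + 2 ≤ i
      · obtain ⟨k, rfl⟩ := Nat.exists_eq_add_of_le c1
        exact slide _ _ (.cross true) j rfl (sw.trans (h.sim_longCap_left n (.cross true) j k d))
      by_cases c2 : j + 1 = i
      · subst c2
        exact absorb j (d + 1) sw
      by_cases c3 : j = i
      · subst c3
        refine vanish (sw.vanish ?_)
        rcases d with _ | d
        · exact h.vanish_cross_cap n j
        · exact (h.vanish_bigon n j).append _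
      by_cases c4 : j + 1 ≤ i + d
      · obtain ⟨a, rfl⟩ := Nat.exists_eq_add_of_le (show i + 1 ≤ j by omega)
        obtain ⟨k, rfl⟩ := Nat.exists_eq_add_of_le (show a + 2 ≤ d by omega)
        exact slide _ _ (.cross true) _ rfl (sw.trans (h.sim_cross_longCap_middle n i a k))
      by_cases c6 : j = i + d
      · subst c6
        obtain ⟨d, rfl⟩ := Nat.exists_eq_add_of_le' (show 1 ≤ d by omega)
        exact vanish (sw.vanish (h.vanish_cross_longCap_right n i d))
      by_cases c7 : j = i + d + 1
      · subst c7
        exact absorb i (d + 1) (sw.trans (h.sim_longCap_extend n i d))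
      obtain ⟨k, rfl⟩ := Nat.exists_eq_add_of_le (show i + d + 2 ≤ j by omega)
      exact slide _ _ (.cross true) _ rfl
        (sw.trans (h.sim_longCap_right n (.cross true) i k d))
    · exact absurd rfl hev

theorem exists_first_cap {w : List Piece} {c : ℕ} (hw : caps w = c + 1) :
    ∃ u i v, w = u ++ cap i :: v ∧ caps u = 0 ∧ caps v = c := by
  induction w with
  | nil => simp at hw
  | cons p w ih =>
    obtain ⟨e, i⟩ := p
    by_cases he : e = .cap
    · subst he
      exact ⟨[], i, w, rfl, rfl, by simpa [Elem.isCap] using hw⟩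
    · have he' : e.isCap = false := by cases e <;> simp_all [Elem.isCap]
      obtain ⟨u, k, v, rfl, h1, h2⟩ := ih (by simpa [he'] using hw)
      exact ⟨⟨e, i⟩ :: u, k, v, rfl, by simp [he', h1], h2⟩

/-- Only maxima lower the width; a minimum raises it, and a crossing needs positive width. -/
theorem le_of_caps_eq_zero {w : List Piece} {n m : ℕ} (hw : IsLinkTangle w n m)
    (hc : caps w = 0) : n ≤ m ∧ (n = 0 → m = 0 → w = []) := by
  induction w generalizing n with
  | nil => simp at hw; simp [hw]
  | cons p w ih =>
    obtain ⟨e, i⟩ := p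
    rw [isLinkTangle_cons] at hw
    rw [caps_cons] at hc
    have := (ih hw.2.2 (by omega)).1
    rcases e with _ | _ | b | _ <;>
      simp [Elem.inWidth, Elem.outWidth, Elem.isCap] at hc hw this ⊢ <;> omega

theorem of_caps (h : IsReductive P N) (c : ℕ) :
    ∀ w, IsLinkTangle w 0 0 → crossings w ≤ N → caps w = c → P w := by
  induction c with
  | zero =>
    intro w hw _ hc
    rw [(le_of_caps_eq_zero hw hc).2 rfl rfl]
    exact h.nil
  | succ c ih =>
    intro w hw hN hc
    obtain ⟨u, i, v, rfl, hu, hv⟩ := exists_first_cap hc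
    exact h.of_longCap ih u i 0 v hu hv hw hN

end IsReductive

end Reduction

/-! ### Uniqueness of the Dubrovnik polynomial and specialisation -/

section Uniqueness

/-- `D` and `D'` agree on the link diagram with the word `w`, if there is one. -/
def Agree {X : Type*} (D D' : LinkDiagram → X) (w : List Piece) : Prop :=
  ∀ L : LinkDiagram, L.word = w → D L = D' L

/-- The link diagram with a given word. -/
def toLinkDiagram (w : List Piece) (h : w ≠ []) (hw : IsLinkTangle w 0 0) : LinkDiagram :=
  ⟨⟨w, h, hw.1⟩, hw.2⟩

theorem linkDiagram_ext {L L' : LinkDiagram} (h : L.word = L'.word) : L = L' := by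
  obtain ⟨⟨w, _, _⟩, _⟩ := L
  obtain ⟨⟨w', _, _⟩, _⟩ := L'
  simp only at h
  subst h
  rfl

theorem agree_toLinkDiagram {X : Type*} {D D' : LinkDiagram → X} {w : List Piece} {h : w ≠ []} {hw : IsLinkTangle w 0 0} :
    Agree D D' w ↔ D (toLinkDiagram w h hw) = D' (toLinkDiagram w h hw) := by
  refine ⟨fun H => H _ rfl, fun H L hL => ?_⟩
  have : L = toLinkDiagram w h hw := linkDiagram_ext hL
  rw [this, H]

theorem IsLinkTangle.isLinkTangle_zero {u v : List Piece} {n : ℕ} (hu : IsLinkTangle u 0 n)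
    (hv : IsLinkTangle v n 0) : IsLinkTangle (u ++ v) 0 0 :=
  isLinkTangle_append.2 ⟨n, hu, hv⟩

/-- A move with empty right side needs a strand to act on, so something lies below it. -/
theorem RegularMove.ne_nil_of_ne_nil {p q u v : List Piece} (hm : RegularMove p q)
    (ht : IsLinkTangle (u ++ (p ++ v)) 0 0) : u ++ (q ++ v) ≠ [] := by
  rcases u with _ | ⟨x, u⟩
  · rw [List.nil_append] at ht
    cases hm <;> simp [Elem.inWidth, Elem.outWidth] at ht ⊢
  · simp

variable {K : Type*} [Field K] {z : K} {a : Kˣ} {D D' : LinkDiagram → K}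

theorem agree_move (h : IsDubrovnik z a D) (h' : IsDubrovnik z a D') {p q : List Piece}
    (hm : RegularMove p q) {u v : List Piece} (ht : IsLinkTangle (u ++ (p ++ v)) 0 0)
    (ht' : IsLinkTangle (u ++ (q ++ v)) 0 0) :
    Agree D D' (u ++ (p ++ v)) ↔ Agree D D' (u ++ (q ++ v)) := by
  have hq := hm.ne_nil_of_ne_nil ht
  have hp : u ++ (p ++ v) ≠ [] := by cases hm <;> simp
  rw [agree_toLinkDiagram (h := hp) (hw := ht), agree_toLinkDiagram (h := hq) (hw := ht'),
    h.regular_isotopy u v p q (toLinkDiagram _ hp ht) (toLinkDiagram _ hq ht') hm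
      (by simp [toLinkDiagram]) (by simp [toLinkDiagram]),
    h'.regular_isotopy u v p q (toLinkDiagram _ hp ht) (toLinkDiagram _ hq ht') hm
      (by simp [toLinkDiagram]) (by simp [toLinkDiagram])]

theorem agree_curl (h : IsDubrovnik z a D) (h' : IsDubrovnik z a D') {p : List Piece} {b : Bool}
    (hc : IsCurl b p) {u v : List Piece} (ht : IsLinkTangle (u ++ v) 0 0) (hne : u ++ v ≠ [])
    (hA : Agree D D' (u ++ v)) : Agree D D' (u ++ (p ++ v)) := by
  intro L hL
  have hL' : L.word = u ++ p ++ v := by rw [hL, List.append_assoc]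
  rw [agree_toLinkDiagram (h := hne) (hw := ht)] at hA
  cases b
  · rw [h.curl_neg u v p L (toLinkDiagram _ hne ht) hc hL' rfl,
      h'.curl_neg u v p L (toLinkDiagram _ hne ht) hc hL' rfl, hA]
  · rw [h.curl_pos u v p L (toLinkDiagram _ hne ht) hc hL' rfl,
      h'.curl_pos u v p L (toLinkDiagram _ hne ht) hc hL' rfl, hA]

/-- The difference of two Dubrovnik polynomials satisfies the skein relation. -/
theorem agree_skein (h : IsDubrovnik z a D) (h' : IsDubrovnik z a D') {u v : List Piece} {i n : ℕ}
    (hu : IsLinkTangle u 0 n) (hi : i + 2 ≤ n) (hv : IsLinkTangle v n 0) :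
    ∃ L₁ L₂ L₃ L₄ : LinkDiagram, L₁.word = u ++ cross true i :: v ∧
      L₂.word = u ++ cross false i :: v ∧ L₃.word = u ++ v ∧
      L₄.word = u ++ cap i :: cup i :: v ∧
      (D L₁ - D' L₁) - (D L₂ - D' L₂) = z * ((D L₃ - D' L₃) - (D L₄ - D' L₄)) := by
  have e1 : n - 2 + 2 = n := by omega
  have hne : u ++ v ≠ [] := by
    rcases u with _ | ⟨x, u⟩
    · simp at hu; omega
    · simp
  have t1 : ∀ b, IsLinkTangle (u ++ cross b i :: v) 0 0 := fun b =>
    isLinkTangle_append.2 ⟨n, hu, by simp [Elem.inWidth, Elem.outWidth, e1, hi, hv]⟩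
  have t3 : IsLinkTangle (u ++ v) 0 0 := isLinkTangle_append.2 ⟨n, hu, hv⟩
  have t4 : IsLinkTangle (u ++ cap i :: cup i :: v) 0 0 :=
    isLinkTangle_append.2 ⟨n, hu, by
      simp [Elem.inWidth, Elem.outWidth, e1, hi, hv]; omega⟩
  refine ⟨toLinkDiagram _ (by simp) (t1 true), toLinkDiagram _ (by simp) (t1 false),
    toLinkDiagram _ hne t3, toLinkDiagram _ (by simp) t4, rfl, rfl, rfl, rfl, ?_⟩
  have s := h.skein u v i (toLinkDiagram _ (by simp) (t1 true))
    (toLinkDiagram _ (by simp) (t1 false)) (toLinkDiagram _ hne t3)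
    (toLinkDiagram _ (by simp) t4) (by simp [toLinkDiagram]) (by simp [toLinkDiagram]) rfl
    (by simp [toLinkDiagram])
  have s' := h'.skein u v i (toLinkDiagram _ (by simp) (t1 true))
    (toLinkDiagram _ (by simp) (t1 false)) (toLinkDiagram _ hne t3)
    (toLinkDiagram _ (by simp) t4) (by simp [toLinkDiagram]) (by simp [toLinkDiagram]) rfl
    (by simp [toLinkDiagram])
  linear_combination s - s'

theorem agree_switch (h : IsDubrovnik z a D) (h' : IsDubrovnik z a D') {u v : List Piece}
    {i n : ℕ} (hu : IsLinkTangle u 0 n) (hi : i + 2 ≤ n) (hv : IsLinkTangle v n 0)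
    (h3 : Agree D D' (u ++ v)) (h4 : Agree D D' (u ++ cap i :: cup i :: v)) :
    Agree D D' (u ++ cross true i :: v) ↔ Agree D D' (u ++ cross false i :: v) := by
  obtain ⟨L₁, L₂, L₃, L₄, w1, w2, w3, w4, s⟩ := agree_skein h h' hu hi hv
  rw [h3 L₃ w3, h4 L₄ w4, sub_self, sub_self, sub_zero, mul_zero] at s
  constructor
  · intro H L hL
    rw [linkDiagram_ext (hL.trans w2.symm)]
    linear_combination H L₁ w1 - s
  · intro H L hL
    rw [linkDiagram_ext (hL.trans w1.symm)]
    linear_combination H L₂ w2 + s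

/-- The skein relation solved for a smoothing, by dividing by `z`. -/
theorem agree_smoothing (hz : z ≠ 0) (h : IsDubrovnik z a D) (h' : IsDubrovnik z a D')
    {u v : List Piece} {i n : ℕ} (hu : IsLinkTangle u 0 n) (hi : i + 2 ≤ n)
    (hv : IsLinkTangle v n 0) (h1 : ∀ b, Agree D D' (u ++ cross b i :: v))
    (h4 : Agree D D' (u ++ cap i :: cup i :: v)) : Agree D D' (u ++ v) := by
  obtain ⟨L₁, L₂, L₃, L₄, w1, w2, w3, w4, s⟩ := agree_skein h h' hu hi hv
  rw [h1 true L₁ w1, h1 false L₂ w2, h4 L₄ w4] at s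
  have s' : z * (D L₃ - D' L₃) = 0 := by linear_combination -s
  rw [mul_eq_zero, or_iff_right hz] at s'
  intro L hL
  rw [linkDiagram_ext (hL.trans w3.symm)]
  exact sub_eq_zero.1 s'

/-- A circle next to a strand is a smoothing of a curl on that strand. The two curls and the other
smoothing, a plain strand, reduce to the diagram without the circle. No bound on crossings is
needed, as curls are evaluated by their axioms. -/
theorem agree_circle_of_pos (hz : z ≠ 0) (h : IsDubrovnik z a D) (h' : IsDubrovnik z a D')
    {u v : List Piece} {i n : ℕ} (hu : IsLinkTangle u 0 n) (hi : i ≤ n) (hn : 0 < n)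
    (hv : IsLinkTangle v n 0) (hA : Agree D D' (u ++ v)) :
    Agree D D' (u ++ cup i :: cap i :: v) := by
  have hne : u ++ v ≠ [] := by
    rcases u with _ | ⟨x, u⟩
    · simp at hu; omega
    · simp
  have ht := hu.isLinkTangle_zero hv
  have hu' : IsLinkTangle (u ++ [cup i]) 0 (n + 2) :=
    isLinkTangle_append.2 ⟨n, hu, by simp [Elem.inWidth, Elem.outWidth, hi]⟩
  have hv' : IsLinkTangle (cap i :: v) (n + 2) 0 := by
    simp [Elem.inWidth, Elem.outWidth, hi, hv]
  have key : ∀ j, j + 2 ≤ n + 2 → (∀ b, IsCurl b [cup i, cross b j, cap i]) →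
      RegularMove [cup i, cap j] [] → RegularMove [cup j, cap i] [] → j ≤ n →
      Agree D D' (u ++ cup i :: cap i :: v) := by
    intro j hj hc hm hm' hjn
    have := agree_smoothing hz h h' (i := j) hu' hj hv'
    simp only [List.append_assoc, List.singleton_append] at this
    refine this (fun b => ?_) ?_
    · exact agree_curl h h' (hc b) ht hne hA
    · have e : IsLinkTangle (cup j :: cap i :: v) n 0 := by
        simp [Elem.inWidth, Elem.outWidth, hi, hjn, hv]
      refine (agree_move h h' hm (u := u) (v := cup j :: cap i :: v) ?_
        (hu.isLinkTangle_zero e)).2 ?_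
      · refine hu.isLinkTangle_zero ?_
        simp [Elem.inWidth, Elem.outWidth, hi, hjn, hv]
      · exact (agree_move h h' hm' (hu.isLinkTangle_zero e) ht).2 hA
  -- The curl is made with the neighbouring strand on the right if there is one, otherwise with the
  -- one on the left.
  by_cases hin : i = n
  · obtain ⟨j, rfl⟩ := Nat.exists_eq_add_of_le' hn
    subst hin
    exact key j (by omega) (fun b => .right b j) (.zigzagRight j) (.zigzagLeft j) (by omega)
  · exact key (i + 1) (by omega) (fun b => .left b i) (.zigzagLeft i) (.zigzagRight i) (by omega)

theorem agree_circle (hz : z ≠ 0) (h : IsDubrovnik z a D) (h' : IsDubrovnik z a D')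
    {u v : List Piece} {i : ℕ} (ht : IsLinkTangle (u ++ cup i :: cap i :: v) 0 0)
    (hu : caps u = 0) (hA : Agree D D' (u ++ v)) : Agree D D' (u ++ cup i :: cap i :: v) := by
  obtain ⟨n, htu, hw⟩ := isLinkTangle_append.1 ht
  have hw' := hw
  simp [Elem.inWidth, Elem.outWidth] at hw'
  obtain ⟨hi, hv⟩ := hw'
  rcases Nat.eq_zero_or_pos n with rfl | hn
  · obtain rfl := (IsReductive.le_of_caps_eq_zero htu hu).2 rfl rfl
    obtain rfl : i = 0 := by omega
    simp only [List.nil_append] at *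
    rcases v with _ | ⟨⟨e, j⟩, v⟩
    -- Here `hA` is vacuous, since the empty word is not a diagram; the normalisation on the circle
    -- takes its place.
    · intro L hL
      rw [h.circle L hL, h'.circle L hL]
    · have hv0 := hv
      rw [isLinkTangle_cons] at hv0
      obtain ⟨hev, hj, hv0⟩ := hv0
      rcases e with _ | _ | b | _ <;> simp [Elem.inWidth, Elem.outWidth] at hj hv0 hev
      subst hj
      -- The circle lies below everything else. Two height exchanges lift it above the minimum that
      -- follows, to the left of its two strands.
      have a1 := agree_circle_of_pos hz h h' (u := [cup 0]) (v := v) (i := 0) (n := 2)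
        (by simp [Elem.inWidth, Elem.outWidth]) (by omega) (by omega) hv0 hA
      have a2 := (agree_move h h' (.exchange .cup .cup 0 0) (u := []) (v := cap 0 :: v)
        (by simpa [Elem.inWidth, Elem.outWidth] using hv0)
        (by simpa [Elem.inWidth, Elem.outWidth] using hv0)).2 a1
      exact (agree_move h h' (.exchange .cap .cup 0 0) (u := [cup 0]) (v := v)
        (by simpa [Elem.inWidth, Elem.outWidth] using hv0)
        (by simpa [Elem.inWidth, Elem.outWidth] using hv0)).2 a2
  · exact agree_circle_of_pos hz h h' htu hi hn hv hA

theorem isReductive_agree (hz : z ≠ 0) (h : IsDubrovnik z a D) (h' : IsDubrovnik z a D') {N : ℕ}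
    (ih : ∀ w, IsLinkTangle w 0 0 → crossings w < N → Agree D D' w) :
    IsReductive (Agree D D') N := by
  constructor
  -- The empty word carries no diagram, so agreement on it is vacuous.
  · intro L hL
    exact absurd hL L.ne_nil
  · intro p q hm u v ht ht'
    exact agree_move h h' hm ht ht'
  · intro i u v ht hN
    obtain ⟨n, hu, hv⟩ := isLinkTangle_append.1 ht
    simp [Elem.inWidth, Elem.outWidth] at hv
    simp [Elem.isCross] at hN
    obtain ⟨hi, hv⟩ := hv
    rw [show n - 2 + 2 = n by omega] at hv
    refine agree_switch h h' hu hi hv (ih _ (hu.isLinkTangle_zero hv) ?_)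
      (ih _ (hu.isLinkTangle_zero ?_) ?_)
    · simp; omega
    · simp [Elem.inWidth, Elem.outWidth, hi, show n - 2 + 2 = n by omega, hv]; omega
    · simp [Elem.isCross]; omega
  · intro i u v ht hN
    obtain ⟨n, hu, hv⟩ := isLinkTangle_append.1 ht
    simp [Elem.inWidth, Elem.outWidth] at hv
    simp [Elem.isCross] at hN
    obtain ⟨hi, hv⟩ := hv
    rw [show n - 2 + 2 = n by omega] at hv
    have t := hu.isLinkTangle_zero hv.2
    exact (agree_move h h' (.reidemeister2 true i) ht t).2 (ih _ t (by simp; omega))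
  · intro i u v ht hN
    obtain ⟨n, hu, hv⟩ := isLinkTangle_append.1 ht
    simp [Elem.inWidth, Elem.outWidth] at hv
    simp [Elem.isCross] at hN
    obtain ⟨hi, hi', hi'', hv⟩ := hv
    have t := hu.isLinkTangle_zero hv
    refine agree_curl h h' (.left true i) t ?_ (ih _ t (by simp; omega))
    rcases u with _ | ⟨x, u⟩
    · simp at hu; omega
    · simp
  · intro i u v ht hu hA
    exact agree_circle hz h h' ht hu hA

/-- The Dubrovnik polynomial is unique if `z` is not zero. -/
theorem IsDubrovnik.unique (hz : z ≠ 0) (h : IsDubrovnik z a D) (h' : IsDubrovnik z a D') :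
    D = D' := by
  -- Strong induction on the number of crossings; the reduction on maxima runs inside each step.
  have key : ∀ N w, IsLinkTangle w 0 0 → crossings w = N → Agree D D' w := by
    intro N
    induction N using Nat.strong_induction_on with
    | _ N ih =>
      intro w hw hN
      exact (isReductive_agree hz h h' fun w hw hc => ih _ hc w hw rfl).of_caps _ w hw hN.le rfl
  funext L
  exact key _ L.word ⟨L.closed, L.no_vertex⟩ rfl L rfl

theorem IsDubrovnik.map {R : Type*} [CommRing R] {z' : R} {a' : Rˣ} {E : LinkDiagram → R}
    (h : IsDubrovnik z' a' E) (φ : R →+* K) (hz : φ z' = z) (ha : φ (a' : R) = a) :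
    IsDubrovnik z a (fun L => φ (E L)) := by
  have hinv : φ ((a'⁻¹ : Rˣ) : R) = ((a⁻¹ : Kˣ) : K) := by
    have : Units.map (φ : R →* K) a' = a := Units.ext ha
    rw [← this, ← map_inv]
    rfl
  constructor
  · intro u v p q L L' hm hL hL'
    rw [h.regular_isotopy u v p q L L' hm hL hL']
  · intro u v p L L' hc hL hL'
    rw [h.curl_pos u v p L L' hc hL hL', map_mul, ha]
  · intro u v p L L' hc hL hL'
    rw [h.curl_neg u v p L L' hc hL hL', map_mul, hinv]
  · intro u v i L₁ L₂ L₃ L₄ h1 h2 h3 h4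
    rw [← map_sub, h.skein u v i L₁ L₂ L₃ L₄ h1 h2 h3 h4, map_mul, map_sub, hz]
  · intro L hL
    rw [h.circle L hL, map_one]

theorem sub_inv_ne_zero (A : Kˣ) (hA : (A : K) ^ 2 ≠ 1) : (A : K) - ((A⁻¹ : Kˣ) : K) ≠ 0 := by
  intro h
  apply hA
  have : (A : K) * ((A : K) - ((A⁻¹ : Kˣ) : K)) = 0 := by rw [h, mul_zero]
  rw [mul_sub, Units.mul_inv] at this
  linear_combination this

theorem dubrovnik_eq_orientationSum (h2 : (2 : K) ≠ 0) (A : Kˣ) (hA : (A : K) ^ 2 ≠ 1) :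
    dubrovnik ((A : K) - ((A⁻¹ : Kˣ) : K)) A = fun L => orientationSum A L.word :=
  IsDubrovnik.unique (sub_inv_ne_zero A hA)
    (Classical.epsilon_spec (p := IsDubrovnik ((A : K) - ((A⁻¹ : Kˣ) : K)) A)
      ⟨_, isDubrovnik_orientationSum A h2⟩)
    (isDubrovnik_orientationSum A h2)

theorem map_bracket {R S : Type*} [CommRing R] [CommRing S] (φ : R →+* S) (A' B' : R)
    (F : List Piece → R) (G : GraphDiagram) (E : LinkDiagram → R)
    (hE : ∀ L, F L.word = E L) :
    φ (bracket A' B' E G) = bracket (φ A') (φ B') (fun L => φ (E L)) G := by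
  rw [bracket_eq_sum_map A' B' E F hE, bracket_eq_sum_map (φ A') (φ B') _ (fun w => φ (F w))
    (fun L => congrArg φ (hE L)), map_states, map_list_sum, List.map_map, List.map_map]
  simp [Function.comp_def]

/-- A link diagram is determined by its word; other words get the value 0. This supplies the word
function that `map_bracket` needs for an arbitrary polynomial. -/
theorem exists_word_function {R : Type*} [Zero R] (E : LinkDiagram → R) :
    ∃ F : List Piece → R, ∀ L : LinkDiagram, F L.word = E L := by
  classical
  refine ⟨fun w => if h : ∃ L : LinkDiagram, L.word = w then E h.choose else 0, fun L => ?_⟩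
  have h : ∃ L' : LinkDiagram, L'.word = L.word := ⟨L, rfl⟩
  exact (dif_pos h).trans (congrArg E (linkDiagram_ext h.choose_spec))

end Uniqueness

end KauffmanVogel

theorem theorem6 {K : Type*} [Field K] (h2 : (2 : K) ≠ 0) (A : Kˣ) (hA : (A : K) ^ 2 ≠ 1) :
    -- the Dubrovnik polynomial exists and is unique at these values of the variables,
    (∃! D : KauffmanVogel.LinkDiagram → K,
      KauffmanVogel.IsDubrovnik ((A : K) - ((A⁻¹ : Kˣ) : K)) A D) ∧
    -- every Kauffman-Vogel polynomial over any ring specialises to `kauffmanVogel A A⁻¹ A`,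
    (∀ {R : Type*} [CommRing R] (A' B' : R) (a' : Rˣ) (D : KauffmanVogel.LinkDiagram → R),
      KauffmanVogel.IsDubrovnik (A' - B') a' D →
      ∀ φ : R →+* K, φ A' = A → φ B' = ((A⁻¹ : Kˣ) : K) → φ (a' : R) = A →
      ∀ G : KauffmanVogel.GraphDiagram,
        φ (KauffmanVogel.bracket A' B' D G) =
          KauffmanVogel.kauffmanVogel (A : K) ((A⁻¹ : Kˣ) : K) A G) ∧
    -- and it is given by the sum over hyperbolic orientations.
    (∀ G : KauffmanVogel.GraphDiagram,
      KauffmanVogel.kauffmanVogel (A : K) ((A⁻¹ : Kˣ) : K) A G =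
        1 / 2 * (-(A : K) - ((A⁻¹ : Kˣ) : K)) ^ G.numVertices *
          ∑ h : KauffmanVogel.HyperbolicOrientation G, ((A ^ h.writhe : Kˣ) : K)) := by
  have hz := KauffmanVogel.sub_inv_ne_zero A hA
  have hD := KauffmanVogel.isDubrovnik_orientationSum A h2
  refine ⟨⟨_, hD, fun D hD' => hD'.unique hz hD⟩, ?_, ?_⟩
  · intro R _ A' B' a' D h φ hA' hB' ha' G
    obtain ⟨F, hF⟩ := KauffmanVogel.exists_word_function D
    -- The composite of `φ` with `D` satisfies the axioms over `K`, so by uniqueness it is the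
    -- orientation sum.
    rw [KauffmanVogel.kauffmanVogel, KauffmanVogel.dubrovnik_eq_orientationSum h2 A hA,
      KauffmanVogel.map_bracket φ A' B' F G D hF, hA', hB',
      (h.map φ (by rw [map_sub, hA', hB']) ha').unique hz hD]
  · intro G
    rw [KauffmanVogel.kauffmanVogel, KauffmanVogel.dubrovnik_eq_orientationSum h2 A hA,
      KauffmanVogel.bracket_orientationSum]
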